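/- **Setting.** For each $n$ there are $G=G(n)$ groups of $n$ individuals, with $G(n)/n\to c\in[0,\infty)$ as $n\to\infty$ (all objects may depend on $n$). Group $g$ has public information $\mathbb I_g$: covariates $X_{ig}\in\mathbb R^{p}$ and a directed friendship matrix $F^g\in\{0,1\}^{n\times n}$ with $F^g_{ii}=0$. Write $N_i^g=\sum_jF^g_{ij}$ and, for $P\in\mathbb R^n$, $\overline P_i=\frac1{N_i^g}\sum_jF^g_{ij}P_j$ ($:=0$ if $N_i^g=0$). Let $\Lambda(x)=(1+e^{-x})^{-1}$; for $\theta=(\overline\beta,\beta')'\in\mathbb R^{1+p}$ and $\zeta=(\mu,\theta)$ let $\Gamma_g(\zeta;P)_i=\Lambda(\overline P_i\overline\beta+X_{ig}'\beta+\mu)$, and let $P_g(\zeta)$ be the solution of $P=\Gamma_g(\zeta;P)$ (unique if $|\overline\beta|<4$). The true parameters are $\zeta_{g0}=(\mu_{g0},\theta_{g0})$ with $\theta_{g0}=\vartheta_{k0}=(\overline\beta_{k0},\beta_{k0}')'$ for $g\in C_{k0}$, where $\vartheta_{10},\dots,\vartheta_{K_00}$ are distinct and fixed, and $C_{10},\dots,C_{K_00}$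 partition $[G]$ with $\#C_{k0}/G\to c_k>0$. With $P_{g0}=P_g(\zeta_{g0})$, outcomes are $Y_{ig}=1\{\overline P_{ig0}\overline\beta_{g0}+X_{ig}'\beta_{g0}+\mu_{g0}>\varepsilon_{ig}\}$, the $\varepsilon_{ig}$ being i.i.d. standard logistic over $i,g$ and independent of all covariates and friendship matrices. Let $\psi_{ig}(P;\zeta)=-Y_{ig}\log\Gamma_g(\zeta;P)_i-(1-Y_{ig})\log(1-\Gamma_g(\zeta;P)_i)$ and $\Psi_{ng}(\zeta;P)=\frac1n\sum_i\psi_{ig}(P;\zeta)$. The parameter spaces $\mathcal A\subset\mathbb R$ and $\Theta\subset\mathbb R^{1+p}$ are compact, and $|\overline\beta|<4$ on $\Theta$. **Estimators.** A *sample NPL fixed point* of group $g$ is a pair $(\zeta,P)$ with $\zeta\in\mathcal A\times\Theta$ minimizing $\Psi_{ng}(\cdot;P)$ over $\mathcal A\times\Theta$ and $P=\Gamma_g(\zeta;P)$; a *population NPL fixed point* is defined in the same way with $\Psi_{ng}$ replaced by $\mathbb E[\Psi_{ng}(\zeta;P)\mid\mathbb I_g]$. The first-step estimate $(\widetilde\zeta_g,\widetilde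 P_g)$ is the sample NPL fixed point, and one with the smallest value of $\Psi_{ng}$ if there are several (it is arbitrary if there is none). Let $Q_{ng}(\theta;P)=\Psi_{ng}(\widehat\mu_g(\theta,P),\theta;P)$ with $\widehat\mu_g(\theta,P)\in\arg\min_{\mu\in\mathcal A}\Psi_{ng}(\mu,\theta;P)$. For any tuning parameters $\rho=\rho_n>0$, the C-Lasso estimate with plugged-in $\widetilde P$ is any $$(\widetilde{\boldsymbol\theta},\widetilde\vartheta)\in\arg\min_{\Theta^{G+K_0}}\ \frac1G\sum_{g}Q_{ng}(\theta_g;\widetilde P_g)+\frac\rho G\sum_{g}\prod_{k\in[K_0]}\|\theta_g-\vartheta_k\|_2 ,$$ numbered so that $\sum_k\|\widetilde\vartheta_k-\vartheta_{k0}\|_2$ is minimal among all renumberings of $\widetilde\vartheta$ (which leave the objective unchanged). Let $\widetilde C_k=\{g:\arg\min_l\|\widetilde\theta_g-\widetilde\vartheta_l\|_2=k\}$, and let $\widetilde E_{knG}$ be the event that some $g\in C_{k0}$ is not in $\widetilde C_k$, and $\widetilde F_{knG}$ the event that some $g\in\widetilde C_k$ is not in $C_{k0}$. **Theorem.** Suppose,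 with constants that do not depend on $n,g,i$: 1. $\max_{i,g}\|X_{ig}\|_\infty<C$ almost surely; 2. $\mu_{g0}$ has distance at least $\delta>0$ from the complement of $\mathcal A$, each $\vartheta_{k0}$ is an interior point of $\Theta$, and, for some $c\in(0,1/2)$, almost surely all $P_{ig0}$ lie in $(c,1-c)$; 3. $\max_k|\overline\beta_{k0}|\in(0,4)$; 4. with probability approaching one, $(\zeta_{g0},P_{g0})$ is an isolated population NPL fixed point for every $g\in[G]$; 5. $\max_{j}\sum_{i}(N_i^g)^{-1}F^g_{ij}<C$ almost surely, for every $g$ (terms with $N_i^g=0$ being $0$); 6. with probability approaching one, for every $g\in[G]$ the matrix $$\frac1n\sum_i\Big[\frac{\partial^2\psi_{ig}(P_g(\zeta);\zeta)}{\partial\zeta\,\partial\zeta'}+\frac{\partial^2\psi_{ig}(P_g(\zeta);\zeta)}{\partial\zeta\,\partial P'}\frac{\partial P_g(\zeta)}{\partial\zeta'}\Big]\quad\text{at }\zeta=\zeta_{g0}$$ is invertible, with inverse bounded by a constant. Then, as $n\to\infty$, $$P\Big(\bigcup_{k}\widetilde E_{knG}\Big)\le\sum_{k}P(\widetilde E_{knG})\to0\quad\text{and}\quad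 P\Big(\bigcup_{k}\widetilde F_{knG}\Big)\le\sum_{k}P(\widetilde F_{knG})\to0 .$$ In particular $\widetilde C_k=C_{k0}$ for all $k\in[K_0]$ with probability approaching one. -/

import Mathlib

open MeasureTheory ProbabilityTheory Filter Topology

/-- Slope vectors `θ = (β̄, β)`: coordinate `0` is the peer effect `β̄`, coordinate `k + 1` is the
coefficient of the `k`-th covariate. The norm is the Euclidean one. -/
abbrev Slope (p : ℕ) : Type := EuclideanSpace ℝ (Fin (p + 1))

/-- Parameters `ζ = (μ, θ)` of one group: fixed effect and slope vector. -/
abbrev Param (p : ℕ) : Type := ℝ × Slope p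

/-- Public information of a group of `n` individuals: covariates and directed friendship matrix
(`F i j = true` means that `i` is influenced by `j`), without self links. -/
structure GroupDesign (n p : ℕ) where
  X : Fin n → Fin p → ℝ
  F : Fin n → Fin n → Bool
  no_self : ∀ i, F i i = false

namespace GroupDesign

variable {n p : ℕ}

/-- The influencers of `i`. -/
def friends (d : GroupDesign n p) (i : Fin n) : Finset (Fin n) :=
  Finset.univ.filter fun j => d.F i j = true

/-- The average `P̄_i` of `P` over the influencers of `i`; it is `0` if there are none
(the sum is then empty). -/
noncomputable def peerMean (d : GroupDesign n p) (P : Fin n → ℝ) (i : Fin n) : ℝ :=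
  ((d.friends i).card : ℝ)⁻¹ * ∑ j ∈ d.friends i, P j

/-- The single index `P̄_i β̄ + X_i' β + μ`. -/
noncomputable def index (d : GroupDesign n p) (ζ : Param p) (P : Fin n → ℝ) (i : Fin n) : ℝ :=
  d.peerMean P i * ζ.2 0 + ∑ k : Fin p, d.X i k * ζ.2 k.succ + ζ.1

/-- The best response map `Γ(ζ; P)`, with logistic link `x ↦ (1 + e^{-x})⁻¹`. -/
noncomputable def bestResponse (d : GroupDesign n p) (ζ : Param p) (P : Fin n → ℝ) : Fin n → ℝ :=
  fun i => Real.sigmoid (d.index ζ P i)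

/-- The equilibrium choice probabilities `P(ζ)`: the solution of `P = Γ(ζ; P)`
(it exists and is unique for `|β̄| < 4`). -/
noncomputable def equilibrium (d : GroupDesign n p) (ζ : Param p) : Fin n → ℝ :=
  Classical.epsilon fun P => P = d.bestResponse ζ P

/-- The outcomes generated by the model with parameter `ζ` and private shocks `e`:
`Y_i = 1{P̄_i(ζ) β̄ + X_i' β + μ > e_i}`. -/
noncomputable def outcome (d : GroupDesign n p) (ζ : Param p) (e : Fin n → ℝ) : Fin n → ℝ :=
  open Classical in fun i => if d.index ζ (d.equilibrium ζ) i > e i then 1 else 0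

/-- The negative log-likelihood `ψ` of individual `i`. -/
noncomputable def indivNegLogLik (d : GroupDesign n p) (Y : Fin n → ℝ) (ζ : Param p)
    (P : Fin n → ℝ) (i : Fin n) : ℝ :=
  -(Y i * Real.log (Real.sigmoid (d.index ζ P i)))
    - (1 - Y i) * Real.log (1 - Real.sigmoid (d.index ζ P i))

/-- The sample criterion `Ψ_{ng}(ζ; P)` of a group. -/
noncomputable def negLogLik (d : GroupDesign n p) (Y : Fin n → ℝ) (ζ : Param p)
    (P : Fin n → ℝ) : ℝ :=
  (1 / (n : ℝ)) * ∑ i, d.indivNegLogLik Y ζ P i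

/-- The population criterion `Ψ_g(ζ; P)`: the expectation of the sample criterion given the public
information, where the shocks have law `ν` and `ζ₀` is the true parameter. -/
noncomputable def popNegLogLik (d : GroupDesign n p) (ν : Measure (Fin n → ℝ)) (ζ₀ ζ : Param p)
    (P : Fin n → ℝ) : ℝ :=
  ∫ e, d.negLogLik (d.outcome ζ₀ e) ζ P ∂ν

/-- The NPL fixed points of a criterion `L` over the parameter space `A × Θ`: pairs `(ζ, P)` such
that `ζ` minimizes `L(·; P)` and `P = Γ(ζ; P)`. -/
def nplFixedPoints (d : GroupDesign n p) (A : Set ℝ) (Θ : Set (Slope p))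
    (L : Param p → (Fin n → ℝ) → ℝ) : Set (Param p × (Fin n → ℝ)) :=
  {q | q.1 ∈ A ×ˢ Θ ∧ (∀ z ∈ A ×ˢ Θ, L q.1 q.2 ≤ L z q.2) ∧ q.2 = d.bestResponse q.1 q.2}

/-- `(ζ, P)` is a first-step NPL estimate from the outcomes `Y`: a sample NPL fixed point, and one
of highest pseudo-likelihood if there are several. -/
def IsNPLEstimate (d : GroupDesign n p) (A : Set ℝ) (Θ : Set (Slope p)) (Y : Fin n → ℝ)
    (q : Param p × (Fin n → ℝ)) : Prop :=
  q ∈ d.nplFixedPoints A Θ (d.negLogLik Y) ∧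
    ∀ q' ∈ d.nplFixedPoints A Θ (d.negLogLik Y), d.negLogLik Y q.1 q.2 ≤ d.negLogLik Y q'.1 q'.2

/-- The true pair `(ζ₀, P(ζ₀))` is an isolated population NPL fixed point. -/
def IsIsolatedPopFixedPoint (d : GroupDesign n p) (A : Set ℝ) (Θ : Set (Slope p))
    (ν : Measure (Fin n → ℝ)) (ζ₀ : Param p) : Prop :=
  (ζ₀, d.equilibrium ζ₀) ∈ d.nplFixedPoints A Θ (d.popNegLogLik ν ζ₀) ∧
    ∃ U ∈ 𝓝 (ζ₀, d.equilibrium ζ₀),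
      U ∩ d.nplFixedPoints A Θ (d.popNegLogLik ν ζ₀) = {(ζ₀, d.equilibrium ζ₀)}

/-- The matrix `n⁻¹ ∑ᵢ [∂²ψᵢ/∂ζ∂ζ' + (∂²ψᵢ/∂ζ∂P') (∂P(ζ)/∂ζ')]` at `(ζ, P(ζ))`, as a linear map
from parameters to linear forms on parameters. -/
noncomputable def nplJacobian (d : GroupDesign n p) (Y : Fin n → ℝ) (ζ : Param p) :
    Param p →L[ℝ] (Param p →L[ℝ] ℝ) :=
  fderiv ℝ (fun z => fderiv ℝ (fun z' => d.negLogLik Y z' (d.equilibrium ζ)) z) ζ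
    + (fderiv ℝ (fun Q => fderiv ℝ (fun z' => d.negLogLik Y z' Q) ζ) (d.equilibrium ζ)).comp
        (fderiv ℝ d.equilibrium ζ)

/-- The profiled fixed effect `μ̂(θ, P)`, a minimizer of `Ψ_{ng}(·, θ; P)` over `A`. -/
noncomputable def muHat (d : GroupDesign n p) (A : Set ℝ) (Y : Fin n → ℝ) (θ : Slope p)
    (P : Fin n → ℝ) : ℝ :=
  Classical.epsilon fun m => m ∈ A ∧ ∀ m' ∈ A, d.negLogLik Y (m, θ) P ≤ d.negLogLik Y (m', θ) P

/-- The profile negative log-likelihood `Q_{ng}(θ; P)`. -/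
noncomputable def profile (d : GroupDesign n p) (A : Set ℝ) (Y : Fin n → ℝ) (θ : Slope p)
    (P : Fin n → ℝ) : ℝ :=
  d.negLogLik Y (d.muHat A Y θ P, θ) P

end GroupDesign

/-- The C-Lasso objective
`G⁻¹ ∑_g Q_{ng}(θ_g; P_g) + (ρ / G) ∑_g ∏_k ‖θ_g - ϑ_k‖₂` with plugged-in choice probabilities. -/
noncomputable def cLassoObjective {n p G K : ℕ} (A : Set ℝ) (ρ : ℝ)
    (d : Fin G → GroupDesign n p) (Y P : Fin G → Fin n → ℝ)
    (θ : Fin G → Slope p) (ϑ : Fin K → Slope p) : ℝ :=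
  (1 / (G : ℝ)) * ∑ g, (d g).profile A (Y g) (θ g) (P g)
    + ρ / (G : ℝ) * ∑ g, ∏ k, ‖θ g - ϑ k‖

/-- `(θ, ϑ)` minimizes the C-Lasso objective over `Θ^{G + K}`. -/
def IsCLassoEstimate {n p G K : ℕ} (A : Set ℝ) (Θ : Set (Slope p)) (ρ : ℝ)
    (d : Fin G → GroupDesign n p) (Y P : Fin G → Fin n → ℝ)
    (θ : Fin G → Slope p) (ϑ : Fin K → Slope p) : Prop :=
  (∀ g, θ g ∈ Θ) ∧ (∀ k, ϑ k ∈ Θ) ∧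
    ∀ (θ' : Fin G → Slope p) (ϑ' : Fin K → Slope p), (∀ g, θ' g ∈ Θ) → (∀ k, ϑ' k ∈ Θ) →
      cLassoObjective A ρ d Y P θ ϑ ≤ cLassoObjective A ρ d Y P θ' ϑ'

/-- The objective does not change when the cluster estimates are permuted. They are numbered
compatibly with the true values if no renumbering brings them closer to the true values. -/
def IsMatched {p K : ℕ} (ϑ ϑ₀ : Fin K → Slope p) : Prop :=
  ∀ τ : Equiv.Perm (Fin K), ∑ k, ‖ϑ k - ϑ₀ k‖ ≤ ∑ k, ‖ϑ (τ k) - ϑ₀ k‖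

/-- The true cluster `C_{k0}`, for the membership map `κ`. -/
def trueCluster {G K : ℕ} (κ : Fin G → Fin K) (k : Fin K) : Set (Fin G) := {g | κ g = k}

/-- The estimated cluster `C̃_k`: groups `g` for which `k` is the minimizer of
`l ↦ ‖θ_g - ϑ_l‖₂`. -/
def estCluster {p G K : ℕ} (θ : Fin G → Slope p) (ϑ : Fin K → Slope p) (k : Fin K) :
    Set (Fin G) :=
  {g | ∀ l, l ≠ k → ‖θ g - ϑ k‖ < ‖θ g - ϑ l‖}

/-- The event of a false exclusion from cluster `k`. -/
def falseExclusion {Ω : Type*} {p G K : ℕ} (κ : Fin G → Fin K) (θ : Fin G → Ω → Slope p)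
    (ϑ : Fin K → Ω → Slope p) (k : Fin K) : Set Ω :=
  {ω | ∃ g ∈ trueCluster κ k, g ∉ estCluster (fun g' => θ g' ω) (fun l => ϑ l ω) k}

/-- The event of a false inclusion into cluster `k`. -/
def falseInclusion {Ω : Type*} {p G K : ℕ} (κ : Fin G → Fin K) (θ : Fin G → Ω → Slope p)
    (ϑ : Fin K → Ω → Slope p) (k : Fin K) : Set Ω :=
  {ω | ∃ g ∈ estCluster (fun g' => θ g' ω) (fun l => ϑ l ω) k, g ∉ trueCluster κ k}

/-- The events `E n` hold with probability approaching one: the (outer) probability of the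
complement tends to zero. -/
def WPA1 {Ω : Type*} [MeasurableSpace Ω] (μ : Measure Ω) (E : ℕ → Set Ω) : Prop :=
  Tendsto (fun n => μ (E n)ᶜ) atTop (𝓝 0)

/-- `ε` has the standard logistic distribution. -/
def IsStdLogistic {Ω : Type*} [MeasurableSpace Ω] (μ : Measure Ω) (ε : Ω → ℝ) : Prop :=
  ∀ x : ℝ, μ {ω | ε ω ≤ x} = ENNReal.ofReal (Real.sigmoid x)

/-!
The proof separates a probabilistic estimate from a deterministic argument with constants that do
not depend on the number of individuals or on the group.

*Noise.* The prediction errors `Y_i - P_i` at the true choice probabilities are, given the public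
information, independent, bounded and centred. Hoeffding's inequality, conditioning on the public
information, a finite net of the parameter space and a union bound over the `O(n)` groups show that
their averages, weighted with a constant, the covariates, or the peer averages of any equilibrium
`P(z)`, are uniformly small with probability approaching one (`GroupDesign.wpa1_noiseLE`). The rest
is deterministic, on this event.

*Equilibrium.* The best response is a contraction in the sup norm with factor `|β̄| / 4 < 1`, so
`z ↦ P(z)` is Lipschitz and differentiable, with a remainder of second order that is uniform over
the designs (`GroupDesign.norm_equilibrium_sub_linear_le`). Along the equilibrium path the score is
the average of `(P(z)_i - Y_i) ⟨·, (1, P̄(z)_i, X_i)⟩`, and its derivative at the truth is the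
Jacobian of the theorem.

*Identification.* If the mean absolute index of a direction `v` is small, then so is the response of
the equilibrium to `v` in mean absolute value, by a truncated Neumann series: sup-norm contraction
controls the tail, bounded total influence controls the head. As the Jacobian is bounded away from
singularity, the mean absolute index dominates the norm of `v` (`GroupDesign.exists_gram_bound`).

*First step.* The quantitative inverse function theorem gives a zero of the score near the truth; by
convexity of the logistic likelihood it is a sample fixed point
(`GroupDesign.exists_sample_fixedPoint`). A first-step estimate has at most its criterion, and
strong convexity together with identification forces the estimated choice probabilities to be
uniformly close to the true ones (`GroupDesign.exists_firstStep_bound`). Hence the profile criteria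
are Lipschitz and separate slopes quadratically from the true ones, up to a small error
(`GroupDesign.exists_profile_bound`).

*C-Lasso* (`exists_cLasso_bound`). Comparison with the true values, which carry no penalty, makes the
group estimates consistent on average over the groups. Given them, the cluster estimates minimize
the penalty alone, whatever its weight; so every true cluster value has a cluster estimate nearby,
and after matching all cluster estimates are consistent. Finally, moving one group estimate to the
estimate of its own cluster removes its penalty, so each group estimate is consistent uniformly over
the groups, and nearest-cluster assignment recovers the true clusters.
-/

/-! ### The logistic link -/

namespace LogisticLink

open Real

/-- The logistic link `σ` is `1/4`-Lipschitz. -/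
lemma abs_sigmoid_sub_le (x y : ℝ) : |sigmoid x - sigmoid y| ≤ 1 / 4 * |x - y| := by
  have h := Convex.norm_image_sub_le_of_norm_hasDerivWithin_le (𝕜 := ℝ) (f := sigmoid)
    (f' := fun x => sigmoid x * (1 - sigmoid x)) (s := Set.univ) (C := 1 / 4) (x := y) (y := x)
    (fun z _ => (hasDerivAt_sigmoid z).hasDerivWithinAt)
    (fun z _ => by
      have h0 := sigmoid_pos z
      have h1 := sigmoid_lt_one z
      rw [Real.norm_eq_abs, abs_le]
      constructor <;> nlinarith [sq_nonneg (sigmoid z - 1 / 2)])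
    convex_univ (Set.mem_univ _) (Set.mem_univ _)
  simpa [Real.norm_eq_abs] using h

lemma sigmoid_deriv_pos (x : ℝ) : 0 < sigmoid x * (1 - sigmoid x) :=
  mul_pos (sigmoid_pos x) (by linarith [sigmoid_lt_one x])

lemma sigmoid_deriv_le (x : ℝ) : sigmoid x * (1 - sigmoid x) ≤ 1 / 4 := by
  nlinarith [sq_nonneg (sigmoid x - 1 / 2)]

lemma abs_sigmoid_deriv_le (x : ℝ) : |sigmoid x * (1 - sigmoid x)| ≤ 1 / 4 := by
  rw [abs_of_pos (sigmoid_deriv_pos x)]; exact sigmoid_deriv_le x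

/-- First-order expansion of `σ` around `x₀`, uniformly for pairs of points near `x₀`. -/
lemma abs_sigmoid_sub_linear_le {x y x₀ r : ℝ} (hx : |x - x₀| ≤ r) (hy : |y - x₀| ≤ r) :
    |sigmoid x - sigmoid y - sigmoid x₀ * (1 - sigmoid x₀) * (x - y)| ≤ r * |x - y| := by
  have h := Convex.norm_image_sub_le_of_norm_hasDerivWithin_le (𝕜 := ℝ)
    (f := fun x => sigmoid x - sigmoid x₀ * (1 - sigmoid x₀) * x)
    (f' := fun x => sigmoid x * (1 - sigmoid x) - sigmoid x₀ * (1 - sigmoid x₀))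
    (s := Metric.closedBall x₀ r) (C := r) (x := y) (y := x)
    (fun z _ => by
      simpa using ((hasDerivAt_sigmoid z).fun_sub
        ((hasDerivAt_id z).const_mul (sigmoid x₀ * (1 - sigmoid x₀)))).hasDerivWithinAt)
    (fun z hz => by
      rw [Metric.mem_closedBall, Real.dist_eq] at hz
      have e : sigmoid z * (1 - sigmoid z) - sigmoid x₀ * (1 - sigmoid x₀)
        = (sigmoid z - sigmoid x₀) * (1 - sigmoid z - sigmoid x₀) := by ring
      have h1 : |1 - sigmoid z - sigmoid x₀| ≤ 1 := by
        rw [abs_le]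
        constructor <;> linarith [sigmoid_pos z, sigmoid_pos x₀, sigmoid_lt_one z,
          sigmoid_lt_one x₀]
      rw [e, Real.norm_eq_abs, abs_mul]
      calc _ ≤ |sigmoid z - sigmoid x₀| * 1 := by gcongr
        _ ≤ r := by linarith [abs_sigmoid_sub_le z x₀, abs_nonneg (z - x₀)])
    (convex_closedBall _ _) (by simpa [Real.dist_eq] using hy) (by simpa [Real.dist_eq] using hx)
  calc _ = |sigmoid x - sigmoid x₀ * (1 - sigmoid x₀) * x
        - (sigmoid y - sigmoid x₀ * (1 - sigmoid x₀) * y)| := by congr 1; ring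
    _ ≤ r * |x - y| := by simpa [Real.norm_eq_abs] using h

/-- The antiderivative `x ↦ log (1 + eˣ)` of the logistic link. -/
noncomputable def softplus (x : ℝ) : ℝ := log (1 + exp x)

lemma hasDerivAt_softplus (x : ℝ) : HasDerivAt softplus (sigmoid x) x := by
  have hp : (1 + exp x) ≠ 0 := by positivity
  have h := ((hasDerivAt_exp x).const_add 1).log hp
  have e : exp x / (1 + exp x) = sigmoid x := by
    rw [sigmoid_def, exp_neg]
    field_simp
    ring
  rw [e] at h
  exact h

/-- The logistic negative log-likelihood is `softplus x - y x`. -/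
lemma neg_log_likelihood_eq (x y : ℝ) :
    -(y * log (sigmoid x)) - (1 - y) * log (1 - sigmoid x) = softplus x - y * x := by
  have hp : (0 : ℝ) < 1 + exp x := by positivity
  have h1 : sigmoid x = exp x / (1 + exp x) := by
    rw [sigmoid_def, exp_neg]
    field_simp
    ring
  have h2 : 1 - sigmoid x = 1 / (1 + exp x) := by
    rw [h1]; field_simp; ring
  rw [h2, h1, log_div (exp_pos x).ne' hp.ne', log_div one_ne_zero hp.ne', log_exp, log_one]
  unfold softplus
  ring

/-- On a bounded interval the convexity of `softplus` is strong. -/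
lemma exists_softplus_strong_convex (B : ℝ) : ∃ k : ℝ, 0 < k ∧ ∀ x y : ℝ, |x| ≤ B → |y| ≤ B →
    softplus y + sigmoid y * (x - y) + k * (x - y) ^ 2 ≤ softplus x := by
  obtain hB | hB := lt_or_ge B 0
  · exact ⟨1, one_pos, fun x y hx _ => absurd (hx.trans_lt hB) (abs_nonneg x).not_gt⟩
  have hc : ContinuousOn (fun x => sigmoid x * (1 - sigmoid x)) (Set.Icc (-B) B) :=
    (continuous_sigmoid.mul (continuous_const.sub continuous_sigmoid)).continuousOn
  obtain ⟨z, -, hz⟩ := isCompact_Icc.exists_isMinOn ⟨0, by simp [hB]⟩ hc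
  set k := sigmoid z * (1 - sigmoid z) with hk
  refine ⟨k / 2, half_pos (sigmoid_deriv_pos z), fun x y hx hy => ?_⟩
  have hd (t : ℝ) : HasDerivAt (fun x => softplus x - k / 2 * x ^ 2) (sigmoid t - k * t) t := by
    have h := (hasDerivAt_softplus t).fun_sub (((hasDerivAt_id t).fun_pow 2).const_mul (k / 2))
    refine h.congr_deriv ?_
    simp only [id, Nat.cast_ofNat]
    ring
  have hmono : MonotoneOn (fun t => sigmoid t - k * t) (Set.Icc (-B) B) := by
    have hd2 (t : ℝ) : HasDerivAt (fun t => sigmoid t - k * t)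
        (sigmoid t * (1 - sigmoid t) - k) t := by
      simpa using (hasDerivAt_sigmoid t).fun_sub ((hasDerivAt_id t).const_mul k)
    refine monotoneOn_of_deriv_nonneg (convex_Icc _ _)
      (fun t _ => (hd2 t).continuousAt.continuousWithinAt)
      (fun t _ => (hd2 t).differentiableAt.differentiableWithinAt) fun t ht => ?_
    rw [(hd2 t).deriv, sub_nonneg]
    exact hz (interior_subset ht)
  have hconv : ConvexOn ℝ (Set.Icc (-B) B) (fun x => softplus x - k / 2 * x ^ 2) := by
    refine MonotoneOn.convexOn_of_deriv (convex_Icc _ _)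
      (fun t _ => (hd t).continuousAt.continuousWithinAt)
      (fun t _ => (hd t).differentiableAt.differentiableWithinAt) ?_
    intro a ha b hb hab
    rw [(hd a).deriv, (hd b).deriv]
    exact hmono (interior_subset ha) (interior_subset hb) hab
  have hx' := abs_le.1 hx
  have hy' := abs_le.1 hy
  rcases lt_trichotomy x y with h | h | h
  · have := hconv.slope_le_of_hasDerivAt hx' hy' h (hd y)
    rw [slope_def_field, div_le_iff₀ (by linarith)] at this
    nlinarith
  · subst h; simp
  · have := hconv.le_slope_of_hasDerivAt hy' hx' h (hd y)
    rw [slope_def_field, le_div_iff₀ (by linarith)] at this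
    nlinarith

/-- `softplus` lies above its tangents. -/
lemma softplus_tangent_le (x y : ℝ) : softplus y + sigmoid y * (x - y) ≤ softplus x := by
  obtain ⟨k, hk, h⟩ := exists_softplus_strong_convex (max |x| |y|)
  nlinarith [h x y (le_max_left _ _) (le_max_right _ _), sq_nonneg (x - y)]

lemma abs_softplus_sub_le (x y : ℝ) : |softplus x - softplus y| ≤ |x - y| := by
  have h := Convex.norm_image_sub_le_of_norm_hasDerivWithin_le (𝕜 := ℝ) (f := softplus)
    (f' := sigmoid) (s := Set.univ) (C := 1) (x := y) (y := x)
    (fun z _ => (hasDerivAt_softplus z).hasDerivWithinAt)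
    (fun z _ => by
      rw [Real.norm_eq_abs, abs_of_pos (sigmoid_pos z)]; exact sigmoid_le_one z)
    convex_univ (Set.mem_univ _) (Set.mem_univ _)
  simpa [Real.norm_eq_abs] using h

end LogisticLink

/-! ### Averages over individuals -/

/-- The average of `f` over `n` individuals. -/
noncomputable def avg {n : ℕ} (f : Fin n → ℝ) : ℝ := (1 / (n : ℝ)) * ∑ i, f i

section avg

variable {n : ℕ} {f g : Fin n → ℝ}

lemma avg_add (f g : Fin n → ℝ) : avg (fun i => f i + g i) = avg f + avg g := by
  simp [avg, Finset.sum_add_distrib, mul_add]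

lemma avg_sub (f g : Fin n → ℝ) : avg (fun i => f i - g i) = avg f - avg g := by
  simp [avg, Finset.sum_sub_distrib, mul_sub]

lemma avg_const_mul (a : ℝ) (f : Fin n → ℝ) : avg (fun i => a * f i) = a * avg f := by
  simp only [avg, ← Finset.mul_sum]; ring

lemma avg_mono (h : ∀ i, f i ≤ g i) : avg f ≤ avg g :=
  mul_le_mul_of_nonneg_left (Finset.sum_le_sum fun i _ => h i) (by positivity)

lemma avg_nonneg (h : ∀ i, 0 ≤ f i) : 0 ≤ avg f :=
  mul_nonneg (by positivity) (Finset.sum_nonneg fun i _ => h i)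

/-- The bound is also valid for `n = 0`, where the average is `0`. -/
lemma avg_le_of_forall_le {B : ℝ} (hB : 0 ≤ B) (h : ∀ i, f i ≤ B) : avg f ≤ B := by
  have h1 : ∑ i, f i ≤ n * B := by
    simpa using Finset.sum_le_card_nsmul Finset.univ f B fun i _ => h i
  rcases Nat.eq_zero_or_pos n with rfl | hn
  · simpa [avg] using hB
  · have : (0 : ℝ) < n := by exact_mod_cast hn
    rw [avg, one_div, inv_mul_le_iff₀ this]
    exact h1

lemma abs_avg_le (f : Fin n → ℝ) : |avg f| ≤ avg fun i => |f i| := by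
  rw [avg, abs_mul, abs_of_nonneg (by positivity : (0 : ℝ) ≤ 1 / n)]
  exact mul_le_mul_of_nonneg_left (Finset.abs_sum_le_sum_abs _ _) (by positivity)

lemma abs_avg_le_of_forall_le {B : ℝ} (hB : 0 ≤ B) (h : ∀ i, |f i| ≤ B) : |avg f| ≤ B :=
  (abs_avg_le f).trans (avg_le_of_forall_le hB h)

/-- Jensen's inequality for the square. -/
lemma sq_avg_abs_le (f : Fin n → ℝ) : avg (fun i => |f i|) ^ 2 ≤ avg fun i => f i ^ 2 := by
  set a := avg (fun i => |f i|) with ha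
  have ha0 : 0 ≤ a := avg_nonneg fun i => abs_nonneg _
  have h1 : avg (fun i => 2 * a * |f i| - f i ^ 2) ≤ a ^ 2 :=
    avg_le_of_forall_le (sq_nonneg a) fun i => by
      nlinarith [sq_nonneg (|f i| - a), sq_abs (f i)]
  rw [avg_sub, avg_const_mul, ← ha] at h1
  nlinarith

end avg

/-! ### The single index and the equilibrium -/

namespace GroupDesign

open LogisticLink

variable {n p : ℕ} (d : GroupDesign n p)

/-- The peer average `P ↦ P̄_i` as a continuous linear form. -/
noncomputable def peerMeanCLM (i : Fin n) : (Fin n → ℝ) →L[ℝ] ℝ :=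
  ((d.friends i).card : ℝ)⁻¹ • ∑ j ∈ d.friends i, ContinuousLinearMap.proj j

lemma peerMeanCLM_apply (i : Fin n) (P : Fin n → ℝ) : d.peerMeanCLM i P = d.peerMean P i := by
  simp [peerMeanCLM, peerMean]

lemma peerMean_sub (P Q : Fin n → ℝ) (i : Fin n) :
    d.peerMean (P - Q) i = d.peerMean P i - d.peerMean Q i := by
  simp only [← peerMeanCLM_apply, map_sub]

lemma peerMean_smul (a : ℝ) (P : Fin n → ℝ) (i : Fin n) :
    d.peerMean (a • P) i = a * d.peerMean P i := by
  simp only [← peerMeanCLM_apply, map_smul, smul_eq_mul]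

/-- The coordinate `θ ↦ θ k` of the slope vector, as a linear form on all parameters. -/
noncomputable def slopeCoord (k : Fin (p + 1)) : Param p →L[ℝ] ℝ :=
  (EuclideanSpace.proj k : Slope p →L[ℝ] ℝ).comp (ContinuousLinearMap.snd ℝ ℝ (Slope p))

@[simp] lemma slopeCoord_apply (k : Fin (p + 1)) (v : Param p) : slopeCoord k v = v.2 k := rfl

/-- For fixed choice probabilities the index is linear in the parameters. -/
noncomputable def indexCLM (P : Fin n → ℝ) (i : Fin n) : Param p →L[ℝ] ℝ :=
  d.peerMean P i • slopeCoord 0 + ∑ k : Fin p, d.X i k • slopeCoord k.succ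
    + ContinuousLinearMap.fst ℝ ℝ (Slope p)

lemma indexCLM_apply (P : Fin n → ℝ) (i : Fin n) (v : Param p) :
    d.indexCLM P i v = d.index v P i := by
  simp [indexCLM, index]

lemma index_sub_param (z z' : Param p) (P : Fin n → ℝ) (i : Fin n) :
    d.index (z - z') P i = d.index z P i - d.index z' P i := by
  simp only [← indexCLM_apply, map_sub]

lemma index_sub_prob (z : Param p) (P P' : Fin n → ℝ) (i : Fin n) :
    d.index z P i - d.index z P' i = z.2 0 * d.peerMean (P - P') i := by
  rw [peerMean_sub]; unfold index; ring

lemma index_sub_index (z z' : Param p) (P P' : Fin n → ℝ) (i : Fin n) :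
    d.index z P i - d.index z' P' i
      = d.index (z - z') P' i + z.2 0 * d.peerMean (P - P') i := by
  rw [index_sub_param, ← index_sub_prob]; ring

lemma abs_coord_le (v : Param p) (k : Fin (p + 1)) : |v.2 k| ≤ ‖v‖ :=
  (PiLp.norm_apply_le v.2 k).trans (norm_snd_le v)

lemma abs_peerMean_le {P : Fin n → ℝ} {r : ℝ} (hr : 0 ≤ r) (hP : ∀ j, |P j| ≤ r) (i : Fin n) :
    |d.peerMean P i| ≤ r := by
  unfold peerMean
  have h1 : |∑ j ∈ d.friends i, P j| ≤ (d.friends i).card * r :=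
    (Finset.abs_sum_le_sum_abs _ _).trans
      (by simpa using Finset.sum_le_card_nsmul (d.friends i) (fun j => |P j|) r fun j _ => hP j)
  rw [abs_mul, abs_of_nonneg (by positivity)]
  rcases Nat.eq_zero_or_pos (d.friends i).card with h | h
  · simpa [h] using hr
  · have : (0 : ℝ) < (d.friends i).card := by exact_mod_cast h
    rwa [inv_mul_le_iff₀ this]

lemma abs_peerMean_le_norm (P : Fin n → ℝ) (i : Fin n) : |d.peerMean P i| ≤ ‖P‖ :=
  d.abs_peerMean_le (norm_nonneg _) (fun j => norm_le_pi_norm P j) i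

/-- Uniform bounds on a design: the covariates and the total influence of every individual are at
most `C`. -/
structure Regular (C : ℝ) : Prop where
  nonneg : 0 ≤ C
  abs_X_le : ∀ i k, |d.X i k| ≤ C
  influence_le : ∀ j, ∑ i, ((d.friends i).card : ℝ)⁻¹ * (if d.F i j then 1 else 0) ≤ C

variable {d}

lemma abs_index_le {C : ℝ} (hd : d.Regular C) {P : Fin n → ℝ} (hP : ∀ j, |P j| ≤ 1)
    (v : Param p) (i : Fin n) : |d.index v P i| ≤ (2 + p * C) * ‖v‖ := by
  have h1 : |d.peerMean P i * v.2 0| ≤ 1 * ‖v‖ := by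
    rw [abs_mul]
    exact mul_le_mul (d.abs_peerMean_le zero_le_one hP i) (abs_coord_le v 0) (abs_nonneg _)
      zero_le_one
  have h2 : |∑ k : Fin p, d.X i k * v.2 k.succ| ≤ p * (C * ‖v‖) := by
    refine (Finset.abs_sum_le_sum_abs _ _).trans ?_
    have := Finset.sum_le_card_nsmul Finset.univ (fun k : Fin p => |d.X i k * v.2 k.succ|)
      (C * ‖v‖) fun k _ => by
        rw [abs_mul]
        exact mul_le_mul (hd.abs_X_le i k) (abs_coord_le v _) (abs_nonneg _) hd.nonneg
    simpa using this
  have h3 : |v.1| ≤ ‖v‖ := norm_fst_le v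
  calc |d.index v P i| ≤ |d.peerMean P i * v.2 0| + |∑ k : Fin p, d.X i k * v.2 k.succ| + |v.1| :=
        abs_add_three _ _ _
    _ ≤ (2 + p * C) * ‖v‖ := by linarith

/-- Bounded total influence makes the peer average bounded in mean absolute value. -/
lemma avg_abs_peerMean_le {C : ℝ} (hd : d.Regular C) (P : Fin n → ℝ) :
    avg (fun i => |d.peerMean P i|) ≤ C * avg (fun i => |P i|) := by
  have h : ∑ i, |d.peerMean P i| ≤ C * ∑ j, |P j| := by
    have h1 (i : Fin n) : |d.peerMean P i|
        ≤ ∑ j, ((d.friends i).card : ℝ)⁻¹ * (if d.F i j then 1 else 0) * |P j| := by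
      unfold peerMean
      rw [abs_mul, abs_of_nonneg (by positivity)]
      calc _ ≤ ((d.friends i).card : ℝ)⁻¹ * ∑ j ∈ d.friends i, |P j| := by
            gcongr; exact Finset.abs_sum_le_sum_abs _ _
        _ = _ := by
            rw [friends, Finset.sum_filter, Finset.mul_sum]
            refine Finset.sum_congr rfl fun j _ => ?_
            split_ifs <;> simp
    calc _ ≤ ∑ i, ∑ j, ((d.friends i).card : ℝ)⁻¹ * (if d.F i j then 1 else 0) * |P j| :=
          Finset.sum_le_sum fun i _ => h1 i
      _ = ∑ j, (∑ i, ((d.friends i).card : ℝ)⁻¹ * (if d.F i j then 1 else 0)) * |P j| := by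
          rw [Finset.sum_comm]
          exact Finset.sum_congr rfl fun j _ => (Finset.sum_mul _ _ _).symm
      _ ≤ ∑ j, C * |P j| := by
          gcongr with j; exact hd.influence_le j
      _ = _ := (Finset.mul_sum _ _ _).symm
  calc avg (fun i => |d.peerMean P i|) ≤ 1 / (n : ℝ) * (C * ∑ j, |P j|) :=
        mul_le_mul_of_nonneg_left h (by positivity)
    _ = _ := by unfold avg; ring

variable (d)

lemma contracting_bestResponse {ζ : Param p} (hζ : |ζ.2 0| < 4) :
    ContractingWith (‖ζ.2 0‖₊ / 4) (d.bestResponse ζ) := by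
  refine ⟨?_, LipschitzWith.of_dist_le_mul fun P Q => ?_⟩
  · rw [← NNReal.coe_lt_coe]
    simp only [NNReal.coe_div, coe_nnnorm, Real.norm_eq_abs, NNReal.coe_one, NNReal.coe_ofNat]
    linarith
  · rw [dist_pi_le_iff (by positivity)]
    intro i
    rw [Real.dist_eq]
    refine (abs_sigmoid_sub_le _ _).trans ?_
    rw [index_sub_prob, abs_mul, dist_eq_norm]
    simp only [NNReal.coe_div, coe_nnnorm, Real.norm_eq_abs, NNReal.coe_ofNat]
    have := mul_le_mul_of_nonneg_left (d.abs_peerMean_le_norm (P - Q) i) (abs_nonneg (ζ.2 0))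
    linarith

lemma equilibrium_eq {ζ : Param p} (hζ : |ζ.2 0| < 4) :
    d.equilibrium ζ = d.bestResponse ζ (d.equilibrium ζ) :=
  Classical.epsilon_spec (p := fun P => P = d.bestResponse ζ P)
    ⟨_, (d.contracting_bestResponse hζ).fixedPoint_isFixedPt.symm⟩

lemma equilibrium_apply {ζ : Param p} (hζ : |ζ.2 0| < 4) (i : Fin n) :
    d.equilibrium ζ i = Real.sigmoid (d.index ζ (d.equilibrium ζ) i) :=
  congrFun (d.equilibrium_eq hζ) i

lemma eq_equilibrium {ζ : Param p} (hζ : |ζ.2 0| < 4) {P : Fin n → ℝ}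
    (hP : P = d.bestResponse ζ P) : P = d.equilibrium ζ :=
  (d.contracting_bestResponse hζ).fixedPoint_unique' hP.symm (d.equilibrium_eq hζ).symm

lemma tendsto_iterate_bestResponse {ζ : Param p} (hζ : |ζ.2 0| < 4) :
    Tendsto (fun m => (d.bestResponse ζ)^[m] 0) atTop (𝓝 (d.equilibrium ζ)) := by
  have h := (d.contracting_bestResponse hζ).tendsto_iterate_fixedPoint 0
  rwa [← (d.contracting_bestResponse hζ).fixedPoint_unique (d.equilibrium_eq hζ).symm] at h

lemma abs_equilibrium_le {ζ : Param p} (hζ : |ζ.2 0| < 4) (i : Fin n) :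
    |d.equilibrium ζ i| ≤ 1 := by
  rw [d.equilibrium_apply hζ, abs_of_pos (Real.sigmoid_pos _)]
  exact Real.sigmoid_le_one _

/-! ### Smoothness of the equilibrium in the parameters -/

/-- A vector that solves a linear system with contraction factor `b / 4`, up to an error `e`, is of
the order of `e`. -/
lemma norm_le_of_contracting {b e : ℝ} (hb : b < 4) (he : 0 ≤ e) {y : Fin n → ℝ}
    (hy : ∀ i, |y i| ≤ e + b / 4 * ‖y‖) : ‖y‖ ≤ 4 / (4 - b) * e := by
  have h0 : ‖y‖ ≤ e + b / 4 * ‖y‖ := by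
    rcases isEmpty_or_nonempty (Fin n) with h | h
    · have : y = 0 := Subsingleton.elim _ _
      simp [this, he]
    · exact (pi_norm_le_iff_of_nonempty _).2 hy
  have h4 : 0 < 4 - b := by linarith
  rw [div_mul_eq_mul_div, le_div_iff₀ h4]
  nlinarith

variable {d}

lemma norm_equilibrium_sub_le {C b : ℝ} (hd : d.Regular C) (hb : b < 4) {z z' : Param p}
    (hz : |z.2 0| ≤ b) (hz' : |z'.2 0| ≤ b) :
    ‖d.equilibrium z - d.equilibrium z'‖ ≤ (2 + p * C) / (4 - b) * ‖z - z'‖ := by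
  have hC := hd.nonneg
  have hb0 : 0 ≤ b := (abs_nonneg _).trans hz
  have h4 : 0 < 4 - b := by linarith
  refine (norm_le_of_contracting (e := 1 / 4 * ((2 + p * C) * ‖z - z'‖)) hb (by positivity)
    fun i => ?_).trans (le_of_eq (by field_simp))
  rw [Pi.sub_apply, d.equilibrium_apply (hz.trans_lt hb), d.equilibrium_apply (hz'.trans_lt hb)]
  refine (abs_sigmoid_sub_le _ _).trans ?_
  rw [index_sub_index]
  have h1 := abs_index_le hd (d.abs_equilibrium_le (hz'.trans_lt hb)) (z - z') i
  have h2 := mul_le_mul hz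
    (d.abs_peerMean_le_norm (d.equilibrium z - d.equilibrium z') i) (abs_nonneg _) hb0
  rw [← abs_mul] at h2
  have h3 := abs_add_le (d.index (z - z') (d.equilibrium z') i)
    (z.2 0 * d.peerMean (d.equilibrium z - d.equilibrium z') i)
  linarith

variable (d)

/-- The derivative `P ↦ σ'(x_i) β̄ P̄_i` of the best response in the choice probabilities, at the
equilibrium. -/
noncomputable def interaction (ζ : Param p) : (Fin n → ℝ) →L[ℝ] (Fin n → ℝ) :=
  ContinuousLinearMap.pi fun i =>
    (d.equilibrium ζ i * (1 - d.equilibrium ζ i) * ζ.2 0) • d.peerMeanCLM i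

/-- The derivative `v ↦ σ'(x_i) ⟨v, (1, P̄_i, X_i)⟩` of the best response in the parameters, at the
equilibrium. -/
noncomputable def directEffect (ζ : Param p) : Param p →L[ℝ] (Fin n → ℝ) :=
  ContinuousLinearMap.pi fun i =>
    (d.equilibrium ζ i * (1 - d.equilibrium ζ i)) • d.indexCLM (d.equilibrium ζ) i

lemma interaction_apply (ζ : Param p) (q : Fin n → ℝ) (i : Fin n) : d.interaction ζ q i
    = d.equilibrium ζ i * (1 - d.equilibrium ζ i) * ζ.2 0 * d.peerMean q i := by
  simp [interaction, peerMeanCLM_apply]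

lemma directEffect_apply (ζ v : Param p) (i : Fin n) : d.directEffect ζ v i
    = d.equilibrium ζ i * (1 - d.equilibrium ζ i) * d.index v (d.equilibrium ζ) i := by
  simp [directEffect, indexCLM_apply]

lemma abs_equilibrium_deriv_le {ζ : Param p} (hζ : |ζ.2 0| < 4) (i : Fin n) :
    |d.equilibrium ζ i * (1 - d.equilibrium ζ i)| ≤ 1 / 4 := by
  rw [d.equilibrium_apply hζ]; exact abs_sigmoid_deriv_le _

lemma abs_interaction_apply_le {ζ : Param p} (hζ : |ζ.2 0| < 4) (q : Fin n → ℝ) (i : Fin n) :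
    |d.interaction ζ q i| ≤ |ζ.2 0| / 4 * |d.peerMean q i| := by
  rw [interaction_apply, abs_mul, abs_mul]
  have := mul_le_mul_of_nonneg_right (d.abs_equilibrium_deriv_le hζ i) (abs_nonneg (ζ.2 0))
  exact mul_le_mul_of_nonneg_right (by linarith) (abs_nonneg _)

lemma norm_interaction_lt_one {ζ : Param p} (hζ : |ζ.2 0| < 4) : ‖d.interaction ζ‖ < 1 := by
  refine (ContinuousLinearMap.opNorm_le_bound _ (by positivity) fun q => ?_).trans_lt
    (show |ζ.2 0| / 4 < 1 by linarith)
  refine (pi_norm_le_iff_of_nonneg (by positivity)).2 fun i => ?_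
  exact (d.abs_interaction_apply_le hζ q i).trans
    (mul_le_mul_of_nonneg_left (d.abs_peerMean_le_norm q i) (by positivity))

/-- By the Neumann series, the linearized equilibrium equation has a solution operator. -/
lemma exists_linearization {ζ : Param p} (hζ : |ζ.2 0| < 4) :
    ∃ D : Param p →L[ℝ] (Fin n → ℝ), ∀ v, D v = directEffect d ζ v + d.interaction ζ (D v) := by
  set u := Units.oneSub (d.interaction ζ) (d.norm_interaction_lt_one hζ) with hu
  refine ⟨(↑u⁻¹ : (Fin n → ℝ) →L[ℝ] (Fin n → ℝ)).comp (d.directEffect ζ), fun v => ?_⟩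
  have h1 : (↑u * ↑u⁻¹ : (Fin n → ℝ) →L[ℝ] (Fin n → ℝ)) (d.directEffect ζ v)
      = d.directEffect ζ v := by rw [Units.mul_inv]; rfl
  have h2 : (u : (Fin n → ℝ) →L[ℝ] (Fin n → ℝ)) = 1 - d.interaction ζ := rfl
  rw [h2] at h1
  simp only [mul_apply_eq_comp, sub_apply, one_apply_eq_self] at h1
  rw [ContinuousLinearMap.comp_apply]
  exact sub_eq_iff_eq_add.1 h1

/-- The derivative of the equilibrium in the parameters: the solution operator of the linearized
equilibrium equation (zero where there is none). -/
noncomputable def equilibriumDeriv (ζ : Param p) : Param p →L[ℝ] (Fin n → ℝ) :=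
  open Classical in
  if h : |ζ.2 0| < 4 then (d.exists_linearization h).choose else 0

lemma equilibriumDeriv_eq {ζ : Param p} (hζ : |ζ.2 0| < 4) (v : Param p) :
    d.equilibriumDeriv ζ v = d.directEffect ζ v + d.interaction ζ (d.equilibriumDeriv ζ v) := by
  unfold equilibriumDeriv
  rw [dif_pos hζ]
  exact (d.exists_linearization hζ).choose_spec v

variable {d}

/-- The Lipschitz constant of the equilibrium in the parameters. -/
noncomputable def lipConst (p : ℕ) (C b : ℝ) : ℝ := (2 + p * C) / (4 - b)

/-- A bound for the second-order remainder of the equilibrium. -/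
noncomputable def remConst (p : ℕ) (C b : ℝ) : ℝ :=
  4 / (4 - b) * ((2 + p * C + b * lipConst p C b) ^ 2 + lipConst p C b)

lemma lipConst_nonneg {C b : ℝ} (hC : 0 ≤ C) (hb : b < 4) : 0 ≤ lipConst p C b := by
  have : 0 < 4 - b := by linarith
  unfold lipConst; positivity

lemma remConst_nonneg {C b : ℝ} (hC : 0 ≤ C) (hb : b < 4) : 0 ≤ remConst p C b := by
  have : 0 < 4 - b := by linarith
  have := lipConst_nonneg (p := p) hC hb
  unfold remConst; positivity

/-- The equilibrium is approximated by its linearization near `ζ`, with constants that depend only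
on the bounds of the design. -/
lemma norm_equilibrium_sub_linear_le {C b r : ℝ} (hd : d.Regular C) (hb : b < 4)
    {ζ z z' : Param p} (hζ : |ζ.2 0| ≤ b) (hz : |z.2 0| ≤ b) (hz' : |z'.2 0| ≤ b)
    (hzr : ‖z - ζ‖ ≤ r) (hzr' : ‖z' - ζ‖ ≤ r) :
    ‖d.equilibrium z - d.equilibrium z' - d.equilibriumDeriv ζ (z - z')‖
      ≤ remConst p C b * r * ‖z - z'‖ := by
  have hC := hd.nonneg
  have hb0 : 0 ≤ b := (abs_nonneg _).trans hz
  have h4 : 0 < 4 - b := by linarith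
  have hr : 0 ≤ r := (norm_nonneg _).trans hzr
  set L := lipConst p C b with hL
  have hL0 : 0 ≤ L := lipConst_nonneg hC hb
  set K : ℝ := 2 + p * C with hK
  have hK0 : 0 ≤ K := by positivity
  set P := d.equilibrium z with hP
  set P' := d.equilibrium z' with hP'
  set P₀ := d.equilibrium ζ with hP₀
  set h := z - z' with hh
  have lip {a a' : Param p} (ha : |a.2 0| ≤ b) (ha' : |a'.2 0| ≤ b) (i : Fin n) :
      |d.index a (d.equilibrium a) i - d.index a' (d.equilibrium a') i|
        ≤ (K + b * L) * ‖a - a'‖ := by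
    rw [index_sub_index]
    have h1 := abs_index_le hd (d.abs_equilibrium_le (ha'.trans_lt hb)) (a - a') i
    have h2 := mul_le_mul ha ((d.abs_peerMean_le_norm (d.equilibrium a - d.equilibrium a') i).trans
      (norm_equilibrium_sub_le hd hb ha ha')) (abs_nonneg _) hb0
    rw [← abs_mul] at h2
    have h3 := abs_add_le (d.index (a - a') (d.equilibrium a') i)
      (a.2 0 * d.peerMean (d.equilibrium a - d.equilibrium a') i)
    have e : b * ((2 + p * C) / (4 - b) * ‖a - a'‖) = b * L * ‖a - a'‖ := by
      rw [hL, lipConst]; ring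
    rw [e] at h2
    linarith
  set e : ℝ := ((K + b * L) ^ 2 + L) * r * ‖h‖ with he
  refine (norm_le_of_contracting (e := e) hb (by positivity) fun i => ?_).trans
    (le_of_eq (by rw [he, remConst]; ring))
  set s := P₀ i * (1 - P₀ i) with hs
  set q := P - P' with hq
  set y := q - d.equilibriumDeriv ζ h with hy
  -- the remainder of `σ` and the variation of the coefficients
  have e1 : y i = (q i - s * (d.index z P i - d.index z' P' i))
      + s * (h.2 0 * d.peerMean (P' - P₀) i + (z.2 0 - ζ.2 0) * d.peerMean q i)
      + s * ζ.2 0 * d.peerMean y i := by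
    have e2 : d.equilibriumDeriv ζ h i
        = s * d.index h P₀ i + s * ζ.2 0 * d.peerMean (d.equilibriumDeriv ζ h) i := by
      conv_lhs => rw [d.equilibriumDeriv_eq (hζ.trans_lt hb), Pi.add_apply, directEffect_apply,
        interaction_apply]
    have e3 := d.index_sub_index z z' P P' i
    have e4 := d.index_sub_prob h P' P₀ i
    have e5 : d.peerMean y i = d.peerMean q i - d.peerMean (d.equilibriumDeriv ζ h) i :=
      d.peerMean_sub _ _ i
    rw [e5, hy, Pi.sub_apply, e2, e3, ← e4, hq]
    ring
  have hs4 : |s| ≤ 1 / 4 := d.abs_equilibrium_deriv_le (hζ.trans_lt hb) i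
  have b1 : |q i - s * (d.index z P i - d.index z' P' i)| ≤ (K + b * L) ^ 2 * r * ‖h‖ := by
    have hx : |d.index z P i - d.index ζ P₀ i| ≤ (K + b * L) * r :=
      (lip hz hζ i).trans (by gcongr)
    have hx' : |d.index z' P' i - d.index ζ P₀ i| ≤ (K + b * L) * r :=
      (lip hz' hζ i).trans (by gcongr)
    have := abs_sigmoid_sub_linear_le hx hx'
    rw [← d.equilibrium_apply (hz.trans_lt hb), ← d.equilibrium_apply (hz'.trans_lt hb),
      ← d.equilibrium_apply (hζ.trans_lt hb)] at this
    refine this.trans ?_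
    calc _ ≤ (K + b * L) * r * ((K + b * L) * ‖h‖) := by
          gcongr; exact lip hz hz' i
      _ = _ := by ring
  have lip0 {a a' : Param p} (ha : |a.2 0| ≤ b) (ha' : |a'.2 0| ≤ b) (i : Fin n) :
      |d.peerMean (d.equilibrium a - d.equilibrium a') i| ≤ L * ‖a - a'‖ :=
    (d.abs_peerMean_le_norm _ i).trans (norm_equilibrium_sub_le hd hb ha ha')
  have b2 : |s * (h.2 0 * d.peerMean (P' - P₀) i + (z.2 0 - ζ.2 0) * d.peerMean q i)|
      ≤ L * r * ‖h‖ := by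
    rw [abs_mul]
    have c1 : |h.2 0 * d.peerMean (P' - P₀) i| ≤ ‖h‖ * (L * r) := by
      rw [abs_mul]
      exact mul_le_mul (abs_coord_le h 0) ((lip0 hz' hζ i).trans (by gcongr)) (abs_nonneg _)
        (norm_nonneg _)
    have c2 : |(z.2 0 - ζ.2 0) * d.peerMean q i| ≤ r * (L * ‖h‖) := by
      rw [abs_mul]
      exact mul_le_mul ((abs_coord_le (z - ζ) 0).trans hzr) (lip0 hz hz' i) (abs_nonneg _) hr
    have c3 : |h.2 0 * d.peerMean (P' - P₀) i + (z.2 0 - ζ.2 0) * d.peerMean q i|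
        ≤ 2 * (L * r * ‖h‖) := (abs_add_le _ _).trans (by linarith)
    have c4 : 0 ≤ L * r * ‖h‖ := by positivity
    calc _ ≤ 1 / 4 * (2 * (L * r * ‖h‖)) := by gcongr
      _ ≤ _ := by linarith
  have b3 : |s * ζ.2 0 * d.peerMean y i| ≤ b / 4 * ‖y‖ := by
    rw [abs_mul, abs_mul]
    refine mul_le_mul ?_ (d.abs_peerMean_le_norm y i) (abs_nonneg _) (by positivity)
    calc _ ≤ 1 / 4 * b := by gcongr
      _ = _ := by ring
  rw [e1]
  refine (abs_add_three _ _ _).trans ?_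
  rw [he]
  linarith

/-- The linearization is the Fréchet derivative of the equilibrium. -/
lemma hasFDerivAt_equilibrium {C : ℝ} (hd : d.Regular C) {ζ : Param p} (hζ : |ζ.2 0| < 4) :
    HasFDerivAt d.equilibrium (d.equilibriumDeriv ζ) ζ := by
  obtain ⟨b, hb1, hb⟩ := exists_between hζ
  have hR := remConst_nonneg (p := p) hd.nonneg hb
  rw [hasFDerivAt_iff_isLittleO, Asymptotics.isLittleO_iff]
  intro c hc
  have hcont : Continuous fun z : Param p => |z.2 0| :=
    (slopeCoord (p := p) 0).continuous.abs
  have h1 : ∀ᶠ z in 𝓝 ζ, |z.2 0| < b := hcont.continuousAt.eventually_lt_const hb1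
  have h2 : ∀ᶠ z in 𝓝 ζ, ‖z - ζ‖ < c / (remConst p C b + 1) := by
    have := Metric.ball_mem_nhds ζ (show 0 < c / (remConst p C b + 1) by positivity)
    filter_upwards [this] with z hz using by rwa [Metric.mem_ball, dist_eq_norm] at hz
  filter_upwards [h1, h2] with z hz1 hz2
  refine (norm_equilibrium_sub_linear_le hd hb hb1.le hz1.le hb1.le le_rfl
    (by simp)).trans ?_
  refine mul_le_mul_of_nonneg_right ?_ (norm_nonneg _)
  rw [lt_div_iff₀ (by positivity)] at hz2
  nlinarith [norm_nonneg (z - ζ)]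

end GroupDesign

/-! ### The score and the Jacobian of the fixed-point equation -/

namespace GroupDesign

open LogisticLink

variable {n p : ℕ} (d : GroupDesign n p)

lemma negLogLik_eq_avg (Y : Fin n → ℝ) (z : Param p) (P : Fin n → ℝ) :
    d.negLogLik Y z P = avg fun i => softplus (d.index z P i) - Y i * d.index z P i := by
  simp only [negLogLik, avg, indivNegLogLik, neg_log_likelihood_eq]

/-- The derivative of the criterion in the parameters, for fixed choice probabilities. -/
noncomputable def score (Y : Fin n → ℝ) (z : Param p) (P : Fin n → ℝ) : Param p →L[ℝ] ℝ :=
  (1 / (n : ℝ)) • ∑ i, (Real.sigmoid (d.index z P i) - Y i) • d.indexCLM P i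

lemma score_apply (Y : Fin n → ℝ) (z : Param p) (P : Fin n → ℝ) (w : Param p) :
    d.score Y z P w = avg fun i => (Real.sigmoid (d.index z P i) - Y i) * d.index w P i := by
  simp [score, avg, indexCLM_apply]

lemma hasFDerivAt_index_param (z : Param p) (P : Fin n → ℝ) (i : Fin n) :
    HasFDerivAt (fun z => d.index z P i) (d.indexCLM P i) z := by
  have := (d.indexCLM P i).hasFDerivAt (x := z)
  exact this.congr_of_eventuallyEq (.of_forall fun v => (d.indexCLM_apply P i v).symm)

lemma hasFDerivAt_peerMean (P : Fin n → ℝ) (i : Fin n) :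
    HasFDerivAt (fun P => d.peerMean P i) (d.peerMeanCLM i) P := by
  have := (d.peerMeanCLM i).hasFDerivAt (x := P)
  exact this.congr_of_eventuallyEq (.of_forall fun v => (d.peerMeanCLM_apply i v).symm)

lemma hasFDerivAt_index_prob (z : Param p) (P : Fin n → ℝ) (i : Fin n) :
    HasFDerivAt (fun P => d.index z P i) (z.2 0 • d.peerMeanCLM i) P := by
  have := ((d.hasFDerivAt_peerMean P i).mul_const (z.2 0)).add_const
    (∑ k : Fin p, d.X i k * z.2 k.succ) |>.add_const z.1
  exact this

lemma hasFDerivAt_indexCLM (P : Fin n → ℝ) (i : Fin n) :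
    HasFDerivAt (fun P => d.indexCLM P i)
      ((d.peerMeanCLM i).smulRight (slopeCoord (p := p) 0)) P :=
  ((d.hasFDerivAt_peerMean P i).smul_const (slopeCoord (p := p) 0)).add_const
    (∑ k : Fin p, d.X i k • slopeCoord k.succ) |>.add_const
      (ContinuousLinearMap.fst ℝ ℝ (Slope p))

lemma hasFDerivAt_negLogLik (Y : Fin n → ℝ) (z : Param p) (P : Fin n → ℝ) :
    HasFDerivAt (fun z => d.negLogLik Y z P) (d.score Y z P) z := by
  have h (i : Fin n) : HasFDerivAt
      (fun z => softplus (d.index z P i) - Y i * d.index z P i)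
      ((Real.sigmoid (d.index z P i) - Y i) • d.indexCLM P i) z := by
    have h1 := (hasDerivAt_softplus (d.index z P i)).comp_hasFDerivAt z
      (d.hasFDerivAt_index_param z P i)
    have h2 := h1.fun_sub ((d.hasFDerivAt_index_param z P i).const_mul (Y i))
    rw [← sub_smul] at h2
    exact h2
  have h3 := (HasFDerivAt.fun_sum fun i (_ : i ∈ Finset.univ) => h i).const_mul (1 / (n : ℝ))
  refine h3.congr_of_eventuallyEq (.of_forall fun v => ?_)
  exact d.negLogLik_eq_avg Y v P

lemma fderiv_negLogLik (Y : Fin n → ℝ) (P : Fin n → ℝ) (z : Param p) :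
    fderiv ℝ (fun z => d.negLogLik Y z P) z = d.score Y z P :=
  (d.hasFDerivAt_negLogLik Y z P).fderiv

lemma hasFDerivAt_score_param (Y : Fin n → ℝ) (z : Param p) (P : Fin n → ℝ) :
    HasFDerivAt (fun z => d.score Y z P)
      ((1 / (n : ℝ)) • ∑ i, ((Real.sigmoid (d.index z P i) * (1 - Real.sigmoid (d.index z P i))) •
        d.indexCLM P i).smulRight (d.indexCLM P i)) z := by
  have h (i : Fin n) : HasFDerivAt
      (fun z => (Real.sigmoid (d.index z P i) - Y i) • d.indexCLM P i)
      (((Real.sigmoid (d.index z P i) * (1 - Real.sigmoid (d.index z P i))) •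
        d.indexCLM P i).smulRight (d.indexCLM P i)) z := by
    have h1 := (Real.hasDerivAt_sigmoid (d.index z P i)).comp_hasFDerivAt z
      (d.hasFDerivAt_index_param z P i)
    exact (h1.sub_const (Y i)).smul_const (d.indexCLM P i)
  exact (HasFDerivAt.fun_sum fun i (_ : i ∈ Finset.univ) => h i).const_smul (1 / (n : ℝ))

lemma hasFDerivAt_score_prob (Y : Fin n → ℝ) (z : Param p) (P : Fin n → ℝ) :
    HasFDerivAt (fun P => d.score Y z P)
      ((1 / (n : ℝ)) • ∑ i, ((Real.sigmoid (d.index z P i) - Y i) •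
          (d.peerMeanCLM i).smulRight (slopeCoord (p := p) 0)
        + ((Real.sigmoid (d.index z P i) * (1 - Real.sigmoid (d.index z P i))) •
          (z.2 0 • d.peerMeanCLM i)).smulRight (d.indexCLM P i))) P := by
  have h (i : Fin n) : HasFDerivAt
      (fun P => (Real.sigmoid (d.index z P i) - Y i) • d.indexCLM P i)
      ((Real.sigmoid (d.index z P i) - Y i) •
          (d.peerMeanCLM i).smulRight (slopeCoord (p := p) 0)
        + ((Real.sigmoid (d.index z P i) * (1 - Real.sigmoid (d.index z P i))) •
          (z.2 0 • d.peerMeanCLM i)).smulRight (d.indexCLM P i)) P := by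
    have h1 := (Real.hasDerivAt_sigmoid (d.index z P i)).comp_hasFDerivAt P
      (d.hasFDerivAt_index_prob z P i)
    exact (h1.sub_const (Y i)).smul (d.hasFDerivAt_indexCLM P i)
  exact (HasFDerivAt.fun_sum fun i (_ : i ∈ Finset.univ) => h i).const_smul (1 / (n : ℝ))

variable {d}

/-- The Jacobian at the true parameters. The derivative of the equilibrium absorbs the curvature of
the criterion, because the fitted probabilities at the equilibrium are the equilibrium itself. -/
lemma nplJacobian_apply {C : ℝ} (hd : d.Regular C) {ζ : Param p} (hζ : |ζ.2 0| < 4)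
    (Y : Fin n → ℝ) (v w : Param p) :
    d.nplJacobian Y ζ v w = avg fun i =>
      d.equilibriumDeriv ζ v i * d.index w (d.equilibrium ζ) i
        + (d.equilibrium ζ i - Y i) * d.peerMean (d.equilibriumDeriv ζ v) i * w.2 0 := by
  unfold nplJacobian
  simp only [fderiv_negLogLik]
  rw [(d.hasFDerivAt_score_param Y ζ (d.equilibrium ζ)).fderiv,
    (d.hasFDerivAt_score_prob Y ζ (d.equilibrium ζ)).fderiv,
    (hasFDerivAt_equilibrium hd hζ).fderiv]
  simp only [add_apply, ContinuousLinearMap.comp_apply, smul_apply,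
    sum_apply, ContinuousLinearMap.smulRight_apply, indexCLM_apply,
    peerMeanCLM_apply, slopeCoord_apply, smul_eq_mul, ← d.equilibrium_apply hζ]
  rw [← mul_add, ← Finset.sum_add_distrib, avg]
  congr 1
  refine Finset.sum_congr rfl fun i _ => ?_
  have e : d.equilibriumDeriv ζ v i
      = d.equilibrium ζ i * (1 - d.equilibrium ζ i) * d.index v (d.equilibrium ζ) i
        + d.equilibrium ζ i * (1 - d.equilibrium ζ i) * ζ.2 0
          * d.peerMean (d.equilibriumDeriv ζ v) i := by
    conv_lhs => rw [d.equilibriumDeriv_eq hζ, Pi.add_apply, directEffect_apply, interaction_apply]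
  conv_rhs => rw [e]
  ring

/-- The score along the equilibrium path `z ↦ P(z)`. -/
lemma score_equilibrium_apply {z : Param p} (hz : |z.2 0| < 4) (Y : Fin n → ℝ) (w : Param p) :
    d.score Y z (d.equilibrium z) w
      = avg fun i => (d.equilibrium z i - Y i) * d.index w (d.equilibrium z) i := by
  simp only [score_apply, ← d.equilibrium_apply hz]

lemma abs_outcome_sub_equilibrium_le {ζ : Param p} (hζ : |ζ.2 0| < 4) {y : ℝ}
    (hy : y ∈ Set.Icc (0 : ℝ) 1) {i : Fin n} : |y - d.equilibrium ζ i| ≤ 1 := by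
  rw [d.equilibrium_apply hζ i, abs_le]
  constructor <;> linarith [hy.1, hy.2, Real.sigmoid_pos (d.index ζ (d.equilibrium ζ) i),
    Real.sigmoid_lt_one (d.index ζ (d.equilibrium ζ) i)]

/-- The constant in the linear approximation of the score along the equilibrium path. -/
noncomputable def scoreConst (p : ℕ) (C b : ℝ) : ℝ :=
  remConst p C b * (3 + p * C) + 2 * lipConst p C b ^ 2

/-- The score along the equilibrium path is approximated by the Jacobian. -/
lemma norm_score_sub_linear_le {C b r : ℝ} (hd : d.Regular C) (hb : b < 4) {Y : Fin n → ℝ}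
    (hY : ∀ i, Y i ∈ Set.Icc (0 : ℝ) 1)
    {ζ z z' : Param p} (hζ : |ζ.2 0| ≤ b) (hz : |z.2 0| ≤ b) (hz' : |z'.2 0| ≤ b)
    (hzr : ‖z - ζ‖ ≤ r) (hzr' : ‖z' - ζ‖ ≤ r) :
    ‖d.score Y z (d.equilibrium z) - d.score Y z' (d.equilibrium z')
        - d.nplJacobian Y ζ (z - z')‖ ≤ scoreConst p C b * r * ‖z - z'‖ := by
  have hC := hd.nonneg
  have hr : 0 ≤ r := (norm_nonneg _).trans hzr
  set L := lipConst p C b with hL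
  have hL0 : 0 ≤ L := lipConst_nonneg hC hb
  set R := remConst p C b with hR
  have hR0 : 0 ≤ R := remConst_nonneg hC hb
  set K : ℝ := 2 + p * C with hK
  have hK0 : 0 ≤ K := by positivity
  set P := d.equilibrium z with hP
  set P' := d.equilibrium z' with hP'
  set P₀ := d.equilibrium ζ with hP₀
  set h := z - z' with hh
  set Dh := d.equilibriumDeriv ζ h with hDh
  have lip {a a' : Param p} (ha : |a.2 0| ≤ b) (ha' : |a'.2 0| ≤ b) :
      ‖d.equilibrium a - d.equilibrium a'‖ ≤ L * ‖a - a'‖ := norm_equilibrium_sub_le hd hb ha ha'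
  have hq : ‖P - P'‖ ≤ L * ‖h‖ := lip hz hz'
  have hy : ‖P - P' - Dh‖ ≤ R * r * ‖h‖ :=
    norm_equilibrium_sub_linear_le hd hb hζ hz hz' hzr hzr'
  have hP1 : ‖P - P₀‖ ≤ L * r := (lip hz hζ).trans (by gcongr)
  have hP2 : ‖P' - P₀‖ ≤ L * r := (lip hz' hζ).trans (by gcongr)
  have hN : 0 ≤ scoreConst p C b := by unfold scoreConst; positivity
  refine ContinuousLinearMap.opNorm_le_bound _ (by positivity) fun w => ?_
  simp only [sub_apply]
  rw [score_equilibrium_apply (hz.trans_lt hb), score_equilibrium_apply (hz'.trans_lt hb),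
    nplJacobian_apply hd (hζ.trans_lt hb), ← avg_sub, ← avg_sub]
  refine abs_avg_le_of_forall_le (by positivity) fun i => ?_
  have e : (P i - Y i) * d.index w P i - (P' i - Y i) * d.index w P' i
      - (Dh i * d.index w P₀ i + (P₀ i - Y i) * d.peerMean Dh i * w.2 0)
      = (P - P' - Dh) i * d.index w P₀ i + (P - P') i * (w.2 0 * d.peerMean (P - P₀) i)
        + ((P₀ i - Y i) * (w.2 0 * d.peerMean (P - P' - Dh) i)
        + (P' - P₀) i * (w.2 0 * d.peerMean (P - P') i)) := by
    simp only [peerMean_sub, Pi.sub_apply]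
    unfold index
    ring
  rw [e]
  have pm (Q : Fin n → ℝ) {B : ℝ} (hQ : ‖Q‖ ≤ B) : |w.2 0 * d.peerMean Q i| ≤ ‖w‖ * B := by
    rw [abs_mul]
    exact mul_le_mul (abs_coord_le w 0) ((d.abs_peerMean_le_norm Q i).trans hQ) (abs_nonneg _)
      (norm_nonneg _)
  have co (Q : Fin n → ℝ) {B : ℝ} (hQ : ‖Q‖ ≤ B) : |Q i| ≤ B := (norm_le_pi_norm Q i).trans hQ
  have t1 : |(P - P' - Dh) i * d.index w P₀ i| ≤ (R * r * ‖h‖) * (K * ‖w‖) := by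
    rw [abs_mul]
    exact mul_le_mul (co _ hy) (abs_index_le hd (d.abs_equilibrium_le (hζ.trans_lt hb)) w i)
      (abs_nonneg _) (by positivity)
  have t2 : |(P - P') i * (w.2 0 * d.peerMean (P - P₀) i)| ≤ (L * ‖h‖) * (‖w‖ * (L * r)) := by
    rw [abs_mul]
    exact mul_le_mul (co _ hq) (pm _ hP1) (abs_nonneg _) (by positivity)
  have hY1 : |P₀ i - Y i| ≤ 1 := by
    rw [abs_sub_comm]
    exact abs_outcome_sub_equilibrium_le (hζ.trans_lt hb) (hY i)
  have t3 : |(P₀ i - Y i) * (w.2 0 * d.peerMean (P - P' - Dh) i)| ≤ 1 * (‖w‖ * (R * r * ‖h‖)) := by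
    rw [abs_mul]
    exact mul_le_mul hY1 (pm _ hy) (abs_nonneg _) zero_le_one
  have t4 : |(P' - P₀) i * (w.2 0 * d.peerMean (P - P') i)| ≤ (L * r) * (‖w‖ * (L * ‖h‖)) := by
    rw [abs_mul]
    exact mul_le_mul (co _ hP2) (pm _ hq) (abs_nonneg _) (by positivity)
  refine (abs_add_le _ _).trans ?_
  refine (add_le_add (abs_add_le _ _) (abs_add_le _ _)).trans ?_
  refine (add_le_add (add_le_add t1 t2) (add_le_add t3 t4)).trans (le_of_eq ?_)
  rw [scoreConst, ← hR, ← hL, hK]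
  ring

/-! ### Sample fixed points near the truth -/

variable (d)

/-- The averages of the prediction errors `Y_i - P_i`, weighted with a constant, with the covariates
or with the peer averages of the equilibria for parameters in `S`, are at most `η`. -/
structure NoiseLE (Y P : Fin n → ℝ) (S : Set (Param p)) (η : ℝ) : Prop where
  const : |avg fun i => Y i - P i| ≤ η
  covariate : ∀ k, |avg fun i => (Y i - P i) * d.X i k| ≤ η
  peer : ∀ z ∈ S, |avg fun i => (Y i - P i) * d.peerMean (d.equilibrium z) i| ≤ η

variable {d}

lemma NoiseLE.abs_avg_index_le {Y P : Fin n → ℝ} {S : Set (Param p)} {η : ℝ}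
    (h : d.NoiseLE Y P S η) {z : Param p} (hz : z ∈ S) (v : Param p) :
    |avg fun i => (Y i - P i) * d.index v (d.equilibrium z) i| ≤ (2 + p) * η * ‖v‖ := by
  have hη : 0 ≤ η := (abs_nonneg _).trans h.const
  have e : (avg fun i => (Y i - P i) * d.index v (d.equilibrium z) i)
      = v.2 0 * (avg fun i => (Y i - P i) * d.peerMean (d.equilibrium z) i)
        + ∑ k : Fin p, v.2 k.succ * (avg fun i => (Y i - P i) * d.X i k)
        + v.1 * (avg fun i => Y i - P i) := by
    have e1 : ∑ k : Fin p, v.2 k.succ * (avg fun i => (Y i - P i) * d.X i k)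
        = avg fun i => ∑ k : Fin p, v.2 k.succ * ((Y i - P i) * d.X i k) := by
      simp only [← avg_const_mul]
      simp only [avg]
      rw [← Finset.mul_sum, Finset.sum_comm]
    rw [e1, ← avg_const_mul, ← avg_const_mul, ← avg_add, ← avg_add]
    congr 1
    funext i
    unfold index
    rw [mul_add, mul_add, Finset.mul_sum]
    congr 1
    · congr 1
      · ring
      · exact Finset.sum_congr rfl fun k _ => by ring
    · ring
  rw [e]
  have h1 : |v.2 0 * (avg fun i => (Y i - P i) * d.peerMean (d.equilibrium z) i)| ≤ ‖v‖ * η := by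
    rw [abs_mul]
    exact mul_le_mul (abs_coord_le v 0) (h.peer z hz) (abs_nonneg _) (norm_nonneg _)
  have h2 : |∑ k : Fin p, v.2 k.succ * (avg fun i => (Y i - P i) * d.X i k)| ≤ p * (‖v‖ * η) := by
    refine (Finset.abs_sum_le_sum_abs _ _).trans ?_
    have := Finset.sum_le_card_nsmul Finset.univ
      (fun k : Fin p => |v.2 k.succ * (avg fun i => (Y i - P i) * d.X i k)|) (‖v‖ * η) fun k _ => by
        rw [abs_mul]
        exact mul_le_mul (abs_coord_le v _) (h.covariate k) (abs_nonneg _) (norm_nonneg _)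
    simpa using this
  have h3 : |v.1 * (avg fun i => Y i - P i)| ≤ ‖v‖ * η := by
    rw [abs_mul]
    exact mul_le_mul (norm_fst_le v) h.const (abs_nonneg _) (norm_nonneg _)
  refine (abs_add_three _ _ _).trans ?_
  linarith

/-- The deterministic conditions on one group with outcomes `Y`, parameter space `S` and true
parameter `ζ`: the design is regular with bound `C`, peer effects in `S` are at most `b < 4`, the
outcomes are in the unit interval, `S` contains the closed `δ`-ball around `ζ`, and the Jacobian at
`ζ` is bounded below by `c`. -/
structure Admissible (d : GroupDesign n p) (S : Set (Param p)) (Y : Fin n → ℝ) (ζ : Param p)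
    (C b δ c : ℝ) : Prop where
  regular : d.Regular C
  lt_four : b < 4
  peer_le : ∀ z ∈ S, |z.2 0| ≤ b
  outcome_mem : ∀ i, Y i ∈ Set.Icc (0 : ℝ) 1
  ball_subset : Metric.closedBall ζ δ ⊆ S
  radius_pos : 0 < δ
  jacobian_pos : 0 < c
  jacobian_le : ∀ v, c * ‖v‖ ≤ ‖d.nplJacobian Y ζ v‖

lemma Admissible.mem {S : Set (Param p)} {Y : Fin n → ℝ} {ζ : Param p} {C b δ c : ℝ}
    (h : d.Admissible S Y ζ C b δ c) : ζ ∈ S :=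
  h.ball_subset (Metric.mem_closedBall_self h.radius_pos.le)

/-- The criterion is convex in the parameters: it lies above its tangent planes. -/
lemma negLogLik_tangent_le (Y : Fin n → ℝ) (z z' : Param p) (P : Fin n → ℝ) :
    d.negLogLik Y z P + d.score Y z P (z' - z) ≤ d.negLogLik Y z' P := by
  rw [negLogLik_eq_avg, negLogLik_eq_avg, score_apply, ← avg_add]
  refine avg_mono fun i => ?_
  rw [index_sub_param]
  have := softplus_tangent_le (d.index z' P i) (d.index z P i)
  linarith

/-- A zero of the score along the equilibrium path exists near the truth, by the quantitative
inverse function theorem; by convexity it is a sample fixed point over any parameter space. -/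
lemma exists_sample_fixedPoint {A : Set ℝ} {Θ : Set (Slope p)} {Y : Fin n → ℝ} {ζ : Param p}
    {C b δ c η r : ℝ} (h : d.Admissible (A ×ˢ Θ) Y ζ C b δ c)
    (hη : d.NoiseLE Y (d.equilibrium ζ) (A ×ˢ Θ) η) (hr : 0 < r) (hrδ : r ≤ δ)
    (hrc : scoreConst p C b * r ≤ c / 2) (hηr : (2 + p) * η ≤ c / 2 * r) :
    ∃ z, ‖z - ζ‖ ≤ r ∧ (z, d.equilibrium z) ∈ d.nplFixedPoints A Θ (d.negLogLik Y) := by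
  have hζS := h.mem
  have hb (z : Param p) (hz : z ∈ Metric.closedBall ζ r) : |z.2 0| ≤ b :=
    h.peer_le z (h.ball_subset (Metric.closedBall_subset_closedBall hrδ hz))
  have hζb : |ζ.2 0| ≤ b := h.peer_le ζ hζS
  have hζ4 := hζb.trans_lt h.lt_four
  have happ : ApproximatesLinearOn (fun z => d.score Y z (d.equilibrium z)) (d.nplJacobian Y ζ)
      (Metric.closedBall ζ r) (c / 2).toNNReal := by
    intro x hx y hy
    have hx' := hx
    have hy' := hy
    rw [Metric.mem_closedBall, dist_eq_norm] at hx' hy'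
    refine (norm_score_sub_linear_le h.regular h.lt_four h.outcome_mem hζb (hb x hx) (hb y hy)
      hx' hy').trans ?_
    rw [Real.coe_toNNReal _ (half_pos h.jacobian_pos).le]
    exact mul_le_mul_of_nonneg_right hrc (norm_nonneg _)
  have hinj : Function.Injective (d.nplJacobian Y ζ) := by
    rw [injective_iff_map_eq_zero]
    intro v hv
    have := h.jacobian_le v
    rw [hv, norm_zero] at this
    have h2 := h.jacobian_pos
    exact norm_le_zero_iff.1 (by nlinarith [norm_nonneg v])
  have hsurj : Function.Surjective (d.nplJacobian Y ζ) := by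
    have hfin : Module.finrank ℝ (Param p) = Module.finrank ℝ (Param p →L[ℝ] ℝ) := by
      rw [← (LinearMap.toContinuousLinearMap (𝕜 := ℝ) (E := Param p) (F' := ℝ)).finrank_eq]
      exact (Subspace.dual_finrank_eq (K := ℝ) (V := Param p)).symm
    exact (LinearMap.injective_iff_surjective_of_finrank_eq_finrank hfin
      (f := (d.nplJacobian Y ζ : Param p →ₗ[ℝ] (Param p →L[ℝ] ℝ)))).1 hinj
  let inv : (d.nplJacobian Y ζ).NonlinearRightInverse :=
    { toFun := fun y => (hsurj y).choose
      nnnorm := (c⁻¹).toNNReal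
      bound' := fun y => by
        have h1 := h.jacobian_le (hsurj y).choose
        rw [(hsurj y).choose_spec] at h1
        rw [Real.coe_toNNReal _ (inv_pos.2 h.jacobian_pos).le, inv_mul_eq_div, le_div_iff₀' h.jacobian_pos]
        exact h1
      right_inv' := fun y => (hsurj y).choose_spec }
  have hs := happ.surjOn_closedBall_of_nonlinearRightInverse inv hr.le (b := ζ) subset_rfl
  have hrad : ((inv.nnnorm : ℝ)⁻¹ - ((c / 2).toNNReal : ℝ)) * r
      = c / 2 * r := by
    simp only [inv]
    rw [Real.coe_toNNReal _ (inv_pos.2 h.jacobian_pos).le,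
      Real.coe_toNNReal _ (half_pos h.jacobian_pos).le, inv_inv]
    ring
  rw [hrad] at hs
  have hη0 : 0 ≤ η := (abs_nonneg _).trans hη.const
  have h0 : (0 : Param p →L[ℝ] ℝ) ∈
      Metric.closedBall (d.score Y ζ (d.equilibrium ζ)) (c / 2 * r) := by
    rw [Metric.mem_closedBall, dist_eq_norm, zero_sub, norm_neg]
    refine ContinuousLinearMap.opNorm_le_bound _
      (by have := h.jacobian_pos; positivity) fun w => ?_
    rw [score_equilibrium_apply hζ4, Real.norm_eq_abs]
    have h1 := hη.abs_avg_index_le hζS w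
    have e : (avg fun i => (d.equilibrium ζ i - Y i) * d.index w (d.equilibrium ζ) i)
        = -avg fun i => (Y i - d.equilibrium ζ i) * d.index w (d.equilibrium ζ) i := by
      rw [← neg_one_mul, ← avg_const_mul]
      congr 1
      funext i
      ring
    rw [e, abs_neg]
    exact h1.trans (mul_le_mul_of_nonneg_right hηr (norm_nonneg _))
  obtain ⟨z, hz, hz0⟩ := hs h0
  have hzS : z ∈ A ×ˢ Θ := h.ball_subset (Metric.closedBall_subset_closedBall hrδ hz)
  refine ⟨z, by rwa [Metric.mem_closedBall, dist_eq_norm] at hz, hzS, fun z' _ => ?_,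
    d.equilibrium_eq ((hb z hz).trans_lt h.lt_four)⟩
  have h1 := d.negLogLik_tangent_le Y z z' (d.equilibrium z)
  have hz0' : d.score Y z (d.equilibrium z) = 0 := hz0
  rw [hz0', zero_apply, add_zero] at h1
  exact h1

end GroupDesign

/-! ### Identification from the Jacobian -/

namespace GroupDesign

open LogisticLink

variable {n p : ℕ} {d : GroupDesign n p}

lemma norm_equilibriumDeriv_le {C b : ℝ} (hd : d.Regular C) (hb : b < 4) {ζ : Param p}
    (hζ : |ζ.2 0| ≤ b) (v : Param p) : ‖d.equilibriumDeriv ζ v‖ ≤ lipConst p C b * ‖v‖ := by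
  have hC := hd.nonneg
  have h4 : 0 < 4 - b := by linarith
  refine (norm_le_of_contracting (e := 1 / 4 * ((2 + p * C) * ‖v‖)) hb (by positivity)
    fun i => ?_).trans (le_of_eq (by rw [lipConst]; field_simp))
  rw [d.equilibriumDeriv_eq (hζ.trans_lt hb), Pi.add_apply, ← d.equilibriumDeriv_eq (hζ.trans_lt hb),
    directEffect_apply]
  refine (abs_add_le _ _).trans (add_le_add ?_ ?_)
  · rw [abs_mul]
    exact mul_le_mul (d.abs_equilibrium_deriv_le (hζ.trans_lt hb) i)
      (abs_index_le hd (d.abs_equilibrium_le (hζ.trans_lt hb)) v i) (abs_nonneg _) (by norm_num)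
  · refine (d.abs_interaction_apply_le (hζ.trans_lt hb) _ i).trans ?_
    exact mul_le_mul (by linarith) (d.abs_peerMean_le_norm _ i) (abs_nonneg _)
      (by linarith [abs_nonneg (ζ.2 0)])

/-- Truncated Neumann series: the interaction is a contraction in the sup norm but only bounded in
mean absolute value, so the response of the equilibrium to `v` is split into a part controlled by
the mean absolute index of `v` and a part that is uniformly small. -/
lemma exists_equilibriumDeriv_split {C b : ℝ} (hd : d.Regular C) (hb : b < 4) {ζ : Param p}
    (hζ : |ζ.2 0| ≤ b) (v : Param p) (m : ℕ) : ∃ y z : Fin n → ℝ,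
      d.equilibriumDeriv ζ v = y + z
      ∧ avg (fun i => |y i|)
        ≤ (∑ k ∈ Finset.range m, C ^ k) * avg (fun i => |d.index v (d.equilibrium ζ) i|)
      ∧ ‖z‖ ≤ (b / 4) ^ m * (lipConst p C b * ‖v‖) := by
  have hC := hd.nonneg
  have hb0 : 0 ≤ b := (abs_nonneg _).trans hζ
  have hζ4 := hζ.trans_lt hb
  have hL := lipConst_nonneg (p := p) hC hb
  induction m with
  | zero => exact ⟨0, d.equilibriumDeriv ζ v, by simp, by simp [avg],
      by simpa using norm_equilibriumDeriv_le hd hb hζ v⟩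
  | succ m ih =>
    obtain ⟨y, z, hyz, hy, hz⟩ := ih
    refine ⟨d.directEffect ζ v + d.interaction ζ y, d.interaction ζ z, ?_, ?_, ?_⟩
    · rw [d.equilibriumDeriv_eq hζ4, hyz, map_add, add_assoc]
    · set u := avg (fun i => |d.index v (d.equilibrium ζ) i|) with hu
      have hu0 : 0 ≤ u := avg_nonneg fun i => abs_nonneg _
      have h1 : avg (fun i => |(d.directEffect ζ v + d.interaction ζ y) i|)
          ≤ avg (fun i => |d.index v (d.equilibrium ζ) i| + |d.peerMean y i|) := by
        refine avg_mono fun i => ?_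
        rw [Pi.add_apply]
        refine (abs_add_le _ _).trans (add_le_add ?_ ?_)
        · rw [directEffect_apply, abs_mul]
          have := mul_le_mul_of_nonneg_right (d.abs_equilibrium_deriv_le hζ4 i)
            (abs_nonneg (d.index v (d.equilibrium ζ) i))
          linarith [abs_nonneg (d.index v (d.equilibrium ζ) i)]
        · refine (d.abs_interaction_apply_le hζ4 y i).trans ?_
          exact mul_le_of_le_one_left (abs_nonneg _) (by linarith)
      rw [avg_add] at h1
      have h2 := avg_abs_peerMean_le hd y
      have h3 := mul_le_mul_of_nonneg_left hy hC
      rw [Finset.sum_range_succ']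
      have h4 : ∑ k ∈ Finset.range m, C ^ (k + 1) = C * ∑ k ∈ Finset.range m, C ^ k := by
        rw [Finset.mul_sum]
        exact Finset.sum_congr rfl fun k _ => pow_succ' C k
      rw [h4, pow_zero]
      nlinarith
    · refine (pi_norm_le_iff_of_nonneg (by positivity)).2 fun i => ?_
      refine (d.abs_interaction_apply_le hζ4 z i).trans ?_
      calc _ ≤ b / 4 * ((b / 4) ^ m * (lipConst p C b * ‖v‖)) := by
            refine mul_le_mul (by linarith) ((d.abs_peerMean_le_norm z i).trans hz)
              (abs_nonneg _) (by positivity)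
        _ = _ := by ring

/-- The prediction errors are nearly orthogonal to the peer averages of the response of the
equilibrium to `v`: approximate the response by a difference quotient of equilibria. -/
lemma abs_avg_noise_response_le {S : Set (Param p)} {Y : Fin n → ℝ} {ζ : Param p}
    {C b δ c η t : ℝ} (h : d.Admissible S Y ζ C b δ c)
    (hη : d.NoiseLE Y (d.equilibrium ζ) S η) (ht : 0 < t) (htδ : t ≤ δ) (v : Param p) :
    |avg fun i => (Y i - d.equilibrium ζ i) * d.peerMean (d.equilibriumDeriv ζ v) i|
      ≤ (2 * η / t + remConst p C b * t) * ‖v‖ := by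
  have hb := h.lt_four
  have hζb := h.peer_le ζ h.mem
  have hR := remConst_nonneg (p := p) h.regular.nonneg hb
  rcases eq_or_ne v 0 with rfl | hv
  · have h0 (i : Fin n) : d.peerMean 0 i = 0 := by
      rw [← peerMeanCLM_apply, map_zero]
    simp [h0, avg]
  have hv0 : 0 < ‖v‖ := norm_pos_iff.2 hv
  set a := t / ‖v‖ with ha
  have ha0 : 0 < a := div_pos ht hv0
  set z := ζ + a • v with hz
  have hzn : ‖z - ζ‖ = t := by
    rw [hz, add_sub_cancel_left, norm_smul, Real.norm_of_nonneg ha0.le, ha,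
      div_mul_cancel₀ _ hv0.ne']
  have hzS : z ∈ S := h.ball_subset (by rw [Metric.mem_closedBall, dist_eq_norm, hzn]; exact htδ)
  set e := d.equilibrium z - d.equilibrium ζ - d.equilibriumDeriv ζ (z - ζ) with he
  have hen : ‖e‖ ≤ remConst p C b * t * t := by
    have := norm_equilibrium_sub_linear_le h.regular hb hζb (h.peer_le z hzS) hζb hzn.le
      (show ‖ζ - ζ‖ ≤ t by simpa using ht.le)
    rwa [hzn] at this
  have key (i : Fin n) : a * ((Y i - d.equilibrium ζ i) * d.peerMean (d.equilibriumDeriv ζ v) i)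
      = (Y i - d.equilibrium ζ i) * d.peerMean (d.equilibrium z) i
        - (Y i - d.equilibrium ζ i) * d.peerMean (d.equilibrium ζ) i
        - (Y i - d.equilibrium ζ i) * d.peerMean e i := by
    have e1 : d.equilibriumDeriv ζ (z - ζ) = a • d.equilibriumDeriv ζ v := by
      rw [hz, add_sub_cancel_left, map_smul]
    rw [he, e1, peerMean_sub, peerMean_sub, peerMean_smul]
    ring
  have h1 : a * (avg fun i => (Y i - d.equilibrium ζ i) * d.peerMean (d.equilibriumDeriv ζ v) i)
      = (avg fun i => (Y i - d.equilibrium ζ i) * d.peerMean (d.equilibrium z) i)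
        - (avg fun i => (Y i - d.equilibrium ζ i) * d.peerMean (d.equilibrium ζ) i)
        - avg fun i => (Y i - d.equilibrium ζ i) * d.peerMean e i := by
    rw [← avg_const_mul, ← avg_sub, ← avg_sub]
    exact congrArg avg (funext key)
  have h2 : |avg fun i => (Y i - d.equilibrium ζ i) * d.peerMean e i|
      ≤ remConst p C b * t * t := by
    refine abs_avg_le_of_forall_le (by positivity) fun i => ?_
    rw [abs_mul]
    calc _ ≤ 1 * (remConst p C b * t * t) :=
          mul_le_mul (abs_outcome_sub_equilibrium_le (hζb.trans_lt hb) (h.outcome_mem i)) (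
            (d.abs_peerMean_le_norm e i).trans hen) (abs_nonneg _) zero_le_one
      _ = _ := one_mul _
  have h3 : a * |avg fun i => (Y i - d.equilibrium ζ i) * d.peerMean (d.equilibriumDeriv ζ v) i|
      ≤ 2 * η + remConst p C b * t * t := by
    rw [← abs_of_pos ha0, ← abs_mul, h1]
    refine (abs_sub _ _).trans ?_
    have h5 := abs_sub (avg fun i => (Y i - d.equilibrium ζ i) * d.peerMean (d.equilibrium z) i)
      (avg fun i => (Y i - d.equilibrium ζ i) * d.peerMean (d.equilibrium ζ) i)
    linarith [hη.peer z hzS, hη.peer ζ h.mem]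
  rw [ha, div_mul_eq_mul_div, div_le_iff₀ hv0] at h3
  have h6 : (2 * η / t + remConst p C b * t) * ‖v‖
      = (2 * η + remConst p C b * t * t) * ‖v‖ / t := by field_simp
  rw [h6, le_div_iff₀ ht]
  linarith

/-- The bound on the inverse Jacobian identifies the parameters from the index: the mean absolute
index of `v` at the true choice probabilities dominates `v`. -/
lemma exists_gram_bound (p : ℕ) {C b δ c : ℝ} (hC : 0 ≤ C) (hb : b < 4)
    (hδ : 0 < δ) (hc : 0 < c) : ∃ γ > 0, ∃ η₀ > 0, ∀ (n : ℕ) (d : GroupDesign n p)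
      (S : Set (Param p)) (Y : Fin n → ℝ) (ζ : Param p) (η : ℝ), η ≤ η₀ →
      d.Admissible S Y ζ C b δ c → d.NoiseLE Y (d.equilibrium ζ) S η → ∀ v,
        γ * ‖v‖ ≤ avg fun i => |d.index v (d.equilibrium ζ) i| := by
  set K : ℝ := 2 + p * C with hK
  have hK0 : 0 < K := by positivity
  set L := lipConst p C b with hL
  have hL0 : 0 ≤ L := lipConst_nonneg hC hb
  set R := remConst p C b with hR
  have hR0 : 0 ≤ R := remConst_nonneg hC hb
  obtain ⟨m, hm⟩ : ∃ m : ℕ, 0 ≤ b → K * ((b / 4) ^ m * L) ≤ c / 4 := by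
    by_cases hb0 : 0 ≤ b
    · obtain ⟨m, hm⟩ := exists_pow_lt_of_lt_one (show 0 < c / (4 * (K * L + 1)) by positivity)
        (show b / 4 < 1 by linarith)
      refine ⟨m, fun _ => ?_⟩
      rw [lt_div_iff₀ (by positivity)] at hm
      have : 0 ≤ (b / 4) ^ m := by positivity
      nlinarith
    · exact ⟨0, fun h => absurd h hb0⟩
  set a := ∑ k ∈ Finset.range m, C ^ k with ha
  have ha0 : 0 ≤ a := Finset.sum_nonneg fun k _ => pow_nonneg hC k
  set t := min δ (c / (8 * (R + 1))) with ht
  have ht0 : 0 < t := lt_min hδ (by positivity)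
  have htR : R * t ≤ c / 8 := by
    have h1 : t ≤ c / (8 * (R + 1)) := min_le_right _ _
    rw [le_div_iff₀ (by positivity)] at h1
    nlinarith
  refine ⟨c / (2 * (K * a + 1)), by positivity, t * c / 16, by positivity,
    fun n d S Y ζ η hη hadm hnoise v => ?_⟩
  have hd := hadm.regular
  have hζb := hadm.peer_le ζ hadm.mem
  have hb0 : 0 ≤ b := (abs_nonneg _).trans hζb
  have hζ4 := hζb.trans_lt hb
  set u := avg (fun i => |d.index v (d.equilibrium ζ) i|) with hu
  have hu0 : 0 ≤ u := avg_nonneg fun i => abs_nonneg _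
  obtain ⟨y, z, hyz, hy, hz⟩ := exists_equilibriumDeriv_split hd hb hζb v m
  have hDv : avg (fun i => |d.equilibriumDeriv ζ v i|)
      ≤ a * u + (b / 4) ^ m * (L * ‖v‖) := by
    have h1 : avg (fun i => |d.equilibriumDeriv ζ v i|) ≤ avg (fun i => |y i| + |z i|) := by
      rw [hyz]
      exact avg_mono fun i => abs_add_le _ _
    rw [avg_add] at h1
    have h2 : avg (fun i => |z i|) ≤ (b / 4) ^ m * (L * ‖v‖) :=
      avg_le_of_forall_le (by positivity) fun i => (norm_le_pi_norm z i).trans hz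
    linarith
  have hnoise2 : |avg fun i =>
      (Y i - d.equilibrium ζ i) * d.peerMean (d.equilibriumDeriv ζ v) i| ≤ c / 4 * ‖v‖ := by
    refine (abs_avg_noise_response_le hadm hnoise ht0 (min_le_left _ _) v).trans ?_
    refine mul_le_mul_of_nonneg_right ?_ (norm_nonneg _)
    have : 2 * η / t ≤ c / 8 := by
      rw [div_le_iff₀ ht0]; linarith
    linarith
  have hM : ‖d.nplJacobian Y ζ v‖
      ≤ K * avg (fun i => |d.equilibriumDeriv ζ v i|) + c / 4 * ‖v‖ := by
    have hDv0 : 0 ≤ avg (fun i => |d.equilibriumDeriv ζ v i|) := avg_nonneg fun i => abs_nonneg _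
    refine ContinuousLinearMap.opNorm_le_bound _ (by positivity) fun w => ?_
    rw [nplJacobian_apply hd hζ4, Real.norm_eq_abs, avg_add]
    have e1 : (avg fun i =>
        (d.equilibrium ζ i - Y i) * d.peerMean (d.equilibriumDeriv ζ v) i * w.2 0)
        = -w.2 0 * avg fun i =>
          (Y i - d.equilibrium ζ i) * d.peerMean (d.equilibriumDeriv ζ v) i := by
      rw [← avg_const_mul]
      exact congrArg avg (funext fun i => by ring)
    rw [e1, add_mul]
    refine (abs_add_le _ _).trans (add_le_add ?_ ?_)
    · refine (abs_avg_le _).trans ?_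
      rw [mul_right_comm, ← avg_const_mul]
      refine avg_mono fun i => ?_
      rw [abs_mul, mul_comm]
      exact mul_le_mul_of_nonneg_right (abs_index_le hd (d.abs_equilibrium_le hζ4) w i)
        (abs_nonneg _)
    · rw [abs_mul, abs_neg, mul_comm]
      exact mul_le_mul hnoise2 (abs_coord_le w 0) (abs_nonneg _) (by positivity)
  have hJ := hadm.jacobian_le v
  have h1 : K * avg (fun i => |d.equilibriumDeriv ζ v i|) ≤ K * a * u + c / 4 * ‖v‖ := by
    have h2 := mul_le_mul_of_nonneg_left hDv hK0.le
    have h3 := mul_le_mul_of_nonneg_right (hm hb0) (norm_nonneg v)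
    nlinarith
  rw [div_mul_eq_mul_div, div_le_iff₀ (by positivity)]
  nlinarith

end GroupDesign

/-! ### Consistency of the first step and the profile criterion -/

namespace GroupDesign

open LogisticLink

variable {n p : ℕ} {d : GroupDesign n p}

lemma abs_index_sub_index_le {C : ℝ} (hd : d.Regular C) {z z' : Param p} {P P' : Fin n → ℝ}
    (hz : |z.2 0| ≤ 4) (hP' : ∀ j, |P' j| ≤ 1) (i : Fin n) :
    |d.index z P i - d.index z' P' i| ≤ (2 + p * C) * ‖z - z'‖ + 4 * ‖P - P'‖ := by
  rw [index_sub_index]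
  refine (abs_add_le _ _).trans (add_le_add (abs_index_le hd hP' _ i) ?_)
  rw [abs_mul]
  exact mul_le_mul hz (d.abs_peerMean_le_norm _ i) (abs_nonneg _) (by norm_num)

lemma negLogLik_le_add {C : ℝ} (hd : d.Regular C) {Y : Fin n → ℝ}
    (hY : ∀ i, Y i ∈ Set.Icc (0 : ℝ) 1) {z z' : Param p} {P P' : Fin n → ℝ}
    (hz : |z.2 0| ≤ 4) (hP' : ∀ j, |P' j| ≤ 1) :
    d.negLogLik Y z P
      ≤ d.negLogLik Y z' P' + 2 * ((2 + p * C) * ‖z - z'‖ + 4 * ‖P - P'‖) := by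
  have hC := hd.nonneg
  rw [← sub_le_iff_le_add', negLogLik_eq_avg, negLogLik_eq_avg, ← avg_sub]
  refine avg_le_of_forall_le (by positivity) fun i => ?_
  have h1 := abs_index_sub_index_le hd (z' := z') (P := P) hz hP' i
  have h2 := (le_abs_self _).trans (abs_softplus_sub_le (d.index z P i) (d.index z' P' i))
  have h3 := abs_le.1 (abs_mul (Y i) (d.index z P i - d.index z' P' i)).le
  rw [abs_of_nonneg (hY i).1] at h3
  have h4 := mul_le_of_le_one_left (abs_nonneg (d.index z P i - d.index z' P' i)) (hY i).2
  linarith [h3.1]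

/-- Strong convexity around the truth: the excess criterion dominates the mean squared deviation of
the index, up to the noise. -/
lemma criterion_gap {k B : ℝ}
    (hk : ∀ x y : ℝ, |x| ≤ B → |y| ≤ B →
      softplus y + Real.sigmoid y * (x - y) + k * (x - y) ^ 2 ≤ softplus x)
    {Y : Fin n → ℝ} {z ζ : Param p} (hζ : |ζ.2 0| < 4) {P : Fin n → ℝ}
    (hz : ∀ i, |d.index z P i| ≤ B) (hzζ : ∀ i, |d.index ζ (d.equilibrium ζ) i| ≤ B) :
    k * (avg fun i => (d.index z P i - d.index ζ (d.equilibrium ζ) i) ^ 2)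
      ≤ d.negLogLik Y z P - d.negLogLik Y ζ (d.equilibrium ζ)
        + avg fun i => (Y i - d.equilibrium ζ i)
          * (d.index z P i - d.index ζ (d.equilibrium ζ) i) := by
  rw [negLogLik_eq_avg, negLogLik_eq_avg, ← avg_sub, ← avg_add, ← avg_const_mul]
  refine avg_mono fun i => ?_
  have h := hk _ _ (hz i) (hzζ i)
  rw [← d.equilibrium_apply hζ] at h
  linarith

/-- A parameter whose equilibrium has an index close to the true one is close to the truth. -/
lemma gram_le_avg_index_sub {C γ : ℝ} (hd : d.Regular C) {z ζ : Param p} (hz : |z.2 0| < 4)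
    (hζ : |ζ.2 0| < 4)
    (hγ : γ * ‖z - ζ‖ ≤ avg fun i => |d.index (z - ζ) (d.equilibrium ζ) i|) :
    γ * ‖z - ζ‖ ≤ (1 + C) * avg fun i =>
      |d.index z (d.equilibrium z) i - d.index ζ (d.equilibrium ζ) i| := by
  set D := fun i => |d.index z (d.equilibrium z) i - d.index ζ (d.equilibrium ζ) i| with hD
  have h1 : avg (fun i => |d.index (z - ζ) (d.equilibrium ζ) i|)
      ≤ avg (fun i => D i + 4 * |d.peerMean (d.equilibrium z - d.equilibrium ζ) i|) := by
    refine avg_mono fun i => ?_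
    have e : d.index (z - ζ) (d.equilibrium ζ) i
        = (d.index z (d.equilibrium z) i - d.index ζ (d.equilibrium ζ) i)
          - z.2 0 * d.peerMean (d.equilibrium z - d.equilibrium ζ) i := by
      rw [index_sub_index]; ring
    rw [e]
    refine (abs_sub _ _).trans (add_le_add le_rfl ?_)
    rw [abs_mul]
    exact mul_le_mul_of_nonneg_right hz.le (abs_nonneg _)
  rw [avg_add, avg_const_mul] at h1
  have h2 := avg_abs_peerMean_le hd (d.equilibrium z - d.equilibrium ζ)
  have h3 : avg (fun i => |(d.equilibrium z - d.equilibrium ζ) i|) ≤ 1 / 4 * avg D := by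
    rw [← avg_const_mul]
    refine avg_mono fun i => ?_
    rw [Pi.sub_apply, d.equilibrium_apply hz, d.equilibrium_apply hζ]
    exact abs_sigmoid_sub_le _ _
  have h4 := mul_le_mul_of_nonneg_left h3 hd.nonneg
  linarith

/-- Uniformly over admissible groups with small noise, sample fixed points exist and the choice
probabilities of every first-step estimate are close to the true ones. -/
lemma exists_firstStep_bound (p : ℕ) {C b δ c Z τ : ℝ} (hC : 0 ≤ C) (hb : b < 4)
    (hδ : 0 < δ) (hc : 0 < c) (hZ : 0 ≤ Z) (hτ : 0 < τ) :
    ∃ η₀ > 0, ∀ (n : ℕ) (d : GroupDesign n p) (A : Set ℝ) (Θ : Set (Slope p)) (Y : Fin n → ℝ)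
      (ζ : Param p) (η : ℝ), η ≤ η₀ → (∀ z ∈ A ×ˢ Θ, ‖z‖ ≤ Z) →
      d.Admissible (A ×ˢ Θ) Y ζ C b δ c → d.NoiseLE Y (d.equilibrium ζ) (A ×ˢ Θ) η →
      (d.nplFixedPoints A Θ (d.negLogLik Y)).Nonempty ∧
      ∀ q, d.IsNPLEstimate A Θ Y q →
        ‖q.2 - d.equilibrium ζ‖ ≤ τ ∧ ∀ i, |q.2 i| ≤ 1 := by
  obtain ⟨γ, hγ, η₁, hη₁, hgram⟩ := exists_gram_bound p hC hb hδ hc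
  set K : ℝ := 2 + p * C with hK
  have hK0 : 0 < K := by positivity
  set L := lipConst p C b with hL
  have hL0 : 0 ≤ L := lipConst_nonneg hC hb
  obtain ⟨k, hk0, hk⟩ := exists_softplus_strong_convex (K * Z)
  have hN0 : 0 ≤ scoreConst p C b := by
    have := remConst_nonneg (p := p) hC hb
    unfold scoreConst; positivity
  set N := scoreConst p C b with hN
  set τ' := τ / (L + 1) with hτ'
  have hτ'0 : 0 < τ' := by positivity
  -- the excess criterion that separates parameters at distance `τ'` from the truth
  set ω := k * (γ * τ' / (1 + C)) ^ 2 with hω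
  have hω0 : 0 < ω := by positivity
  set r := min δ (min (c / (2 * (N + 1))) (ω / (4 * (K + 4 * L)))) with hr
  have hKL : 0 < K + 4 * L := by positivity
  have hr0 : 0 < r := lt_min hδ (lt_min (by positivity) (by positivity))
  have hrN : N * r ≤ c / 2 := by
    have h1 : r ≤ c / (2 * (N + 1)) := (min_le_right _ _).trans (min_le_left _ _)
    rw [le_div_iff₀ (by positivity)] at h1
    nlinarith
  have hrω : 2 * ((K + 4 * L) * r) ≤ ω / 2 := by
    have h1 : r ≤ ω / (4 * (K + 4 * L)) := (min_le_right _ _).trans (min_le_right _ _)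
    rw [le_div_iff₀ (by positivity)] at h1
    linarith
  have hp : (0 : ℝ) ≤ p := Nat.cast_nonneg p
  refine ⟨min η₁ (min (c / 2 * r / (2 + p)) (ω / (8 * (2 + p) * (Z + 1)))),
    lt_min hη₁ (lt_min (by positivity) (by positivity)), fun n d A Θ Y ζ η hη hbd hadm hnoise => ?_⟩
  have hη0 : 0 ≤ η := (abs_nonneg _).trans hnoise.const
  have hηr : (2 + p) * η ≤ c / 2 * r := by
    have h1 := hη.trans ((min_le_right _ _).trans (min_le_left _ _))
    rw [le_div_iff₀ (by positivity)] at h1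
    linarith
  have hηω : 2 * ((2 + p) * η * Z) < ω / 2 := by
    have h1 := hη.trans ((min_le_right _ _).trans (min_le_right _ _))
    rw [le_div_iff₀ (by positivity)] at h1
    nlinarith [mul_nonneg hη0 hZ, mul_nonneg (mul_nonneg hp hη0) hZ, mul_nonneg hp hη0]
  have hd := hadm.regular
  have hζb := hadm.peer_le ζ hadm.mem
  have hζ4 := hζb.trans_lt hb
  obtain ⟨z₁, hz₁, hfix⟩ := exists_sample_fixedPoint hadm hnoise hr0 (min_le_left _ _) hrN hηr
  refine ⟨⟨_, hfix⟩, fun q hq => ?_⟩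
  obtain ⟨z, P⟩ := q
  have hzS : z ∈ A ×ˢ Θ := hq.1.1
  have hzb := hadm.peer_le z hzS
  have hz4 := hzb.trans_lt hb
  have hP : P = d.equilibrium z := d.eq_equilibrium hz4 hq.1.2.2
  subst hP
  refine ⟨?_, d.abs_equilibrium_le hz4⟩
  have hz₁b := hadm.peer_le z₁ hfix.1
  -- the estimate has at most the criterion of the fixed point near the truth
  have h1 : d.negLogLik Y z (d.equilibrium z)
      ≤ d.negLogLik Y ζ (d.equilibrium ζ) + ω / 2 := by
    have h2 := hq.2 _ hfix
    have h3 := negLogLik_le_add hd hadm.outcome_mem (z := z₁) (z' := ζ) (P := d.equilibrium z₁)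
      (hz₁b.trans hb.le) (d.abs_equilibrium_le hζ4)
    have h4 : ‖d.equilibrium z₁ - d.equilibrium ζ‖ ≤ L * r :=
      (norm_equilibrium_sub_le hd hb hz₁b hζb).trans (by gcongr; exact le_rfl)
    have h5 : (2 + p * C) * ‖z₁ - ζ‖ ≤ K * r := mul_le_mul_of_nonneg_left hz₁ hK0.le
    change d.negLogLik Y z (d.equilibrium z) ≤ d.negLogLik Y z₁ (d.equilibrium z₁) at h2
    linarith
  have hidx (z' : Param p) (hz' : z' ∈ A ×ˢ Θ) (i : Fin n) :
      |d.index z' (d.equilibrium z') i| ≤ K * Z :=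
    (abs_index_le hd (d.abs_equilibrium_le ((hadm.peer_le z' hz').trans_lt hb)) z' i).trans
      (mul_le_mul_of_nonneg_left (hbd z' hz') hK0.le)
  have h6 := criterion_gap hk (Y := Y) hζ4 (hidx z hzS) (hidx ζ hadm.mem)
  have h7 (z' : Param p) (hz' : z' ∈ A ×ˢ Θ) : |avg fun i => (Y i - d.equilibrium ζ i)
      * d.index z' (d.equilibrium z') i| ≤ (2 + p) * η * Z :=
    (hnoise.abs_avg_index_le hz' z').trans
      (mul_le_mul_of_nonneg_left (hbd z' hz') (by positivity))
  have h8 : (avg fun i => (Y i - d.equilibrium ζ i)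
      * (d.index z (d.equilibrium z) i - d.index ζ (d.equilibrium ζ) i)) < ω / 2 := by
    have e : (avg fun i => (Y i - d.equilibrium ζ i)
        * (d.index z (d.equilibrium z) i - d.index ζ (d.equilibrium ζ) i))
        = (avg fun i => (Y i - d.equilibrium ζ i) * d.index z (d.equilibrium z) i)
          - avg fun i => (Y i - d.equilibrium ζ i) * d.index ζ (d.equilibrium ζ) i := by
      rw [← avg_sub]
      exact congrArg avg (funext fun i => mul_sub _ _ _)
    rw [e]
    have ha := (abs_le.1 (h7 z hzS)).2
    have hb := (abs_le.1 (h7 ζ hadm.mem)).1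
    linarith
  have h9 := gram_le_avg_index_sub hd hz4 hζ4
    (hgram n d _ Y ζ η (hη.trans (min_le_left _ _)) hadm hnoise (z - ζ))
  have h10 := sq_avg_abs_le fun i =>
    d.index z (d.equilibrium z) i - d.index ζ (d.equilibrium ζ) i
  set a := avg fun i => |d.index z (d.equilibrium z) i - d.index ζ (d.equilibrium ζ) i| with ha
  have ha0 : 0 ≤ a := avg_nonneg fun i => abs_nonneg _
  have h11 : k * a ^ 2 < ω := by
    have := mul_le_mul_of_nonneg_left h10 hk0.le
    linarith
  have h12 : a < γ * τ' / (1 + C) := by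
    rw [hω] at h11
    exact lt_of_pow_lt_pow_left₀ 2 (by positivity) (lt_of_mul_lt_mul_left h11 hk0.le)
  rw [lt_div_iff₀ (by positivity)] at h12
  have h13 : ‖z - ζ‖ ≤ τ' := (lt_of_mul_lt_mul_left (by linarith) hγ.le).le
  calc ‖d.equilibrium z - d.equilibrium ζ‖ ≤ L * ‖z - ζ‖ :=
        norm_equilibrium_sub_le hd hb hzb hζb
    _ ≤ L * τ' := by gcongr
    _ ≤ (L + 1) * τ' := by linarith
    _ = τ := by rw [hτ']; field_simp

lemma muHat_spec {A : Set ℝ} (hA : IsCompact A) (hA0 : A.Nonempty) (Y : Fin n → ℝ) (θ : Slope p)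
    (P : Fin n → ℝ) : d.muHat A Y θ P ∈ A ∧
      ∀ m ∈ A, d.profile A Y θ P ≤ d.negLogLik Y (m, θ) P := by
  have hcont : Continuous fun m : ℝ => d.negLogLik Y (m, θ) P := by
    have h : Differentiable ℝ fun z => d.negLogLik Y z P :=
      fun z => (d.hasFDerivAt_negLogLik Y z P).differentiableAt
    exact h.continuous.comp (by fun_prop)
  obtain ⟨m, hm, hmin⟩ := hA.exists_isMinOn hA0 hcont.continuousOn
  exact Classical.epsilon_spec (p := fun m => m ∈ A ∧ ∀ m' ∈ A,
    d.negLogLik Y (m, θ) P ≤ d.negLogLik Y (m', θ) P) ⟨m, hm, fun m' hm' => hmin hm'⟩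

/-- Uniformly over admissible groups with small noise, sample fixed points exist, and the profile
criterion with the estimated choice probabilities is Lipschitz in the slopes and separates them
quadratically from the true ones, up to `ω`. -/
lemma exists_profile_bound (p : ℕ) {C b δ c Z : ℝ} (hC : 0 ≤ C) (hb : b < 4)
    (hδ : 0 < δ) (hc : 0 < c) (hZ : 0 ≤ Z) :
    ∃ a > 0, ∃ Λ ≥ 0, ∀ ω > 0, ∃ η > 0, ∀ (n : ℕ) (d : GroupDesign n p) (A : Set ℝ)
      (Θ : Set (Slope p)) (Y : Fin n → ℝ) (ζ : Param p), IsCompact A →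
      (∀ z ∈ A ×ˢ Θ, ‖z‖ ≤ Z) →
      d.Admissible (A ×ˢ Θ) Y ζ C b δ c → d.NoiseLE Y (d.equilibrium ζ) (A ×ˢ Θ) η →
      (d.nplFixedPoints A Θ (d.negLogLik Y)).Nonempty ∧
      ∀ q, d.IsNPLEstimate A Θ Y q →
        (∀ θ ∈ Θ, a * ‖θ - ζ.2‖ ^ 2
          ≤ d.profile A Y θ q.2 - d.profile A Y ζ.2 q.2 + ω) ∧
        ∀ θ ∈ Θ, ∀ θ' ∈ Θ, d.profile A Y θ q.2 ≤ d.profile A Y θ' q.2 + Λ * ‖θ - θ'‖ := by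
  obtain ⟨γ, hγ, η₁, hη₁, hgram⟩ := exists_gram_bound p hC hb hδ hc
  set K : ℝ := 2 + p * C with hK
  have hK0 : 0 < K := by positivity
  obtain ⟨k, hk0, hk⟩ := exists_softplus_strong_convex (K * Z)
  have hp : (0 : ℝ) ≤ p := Nat.cast_nonneg p
  refine ⟨k * γ ^ 2, by positivity, 2 * K, by positivity, fun ω hω => ?_⟩
  obtain ⟨η₂, hη₂, hfirst⟩ := exists_firstStep_bound p hC hb hδ hc hZ
    (show 0 < ω / 32 by positivity)
  set η := min (min η₁ η₂) (ω / (4 * ((2 + p) * (Z + 1)))) with hη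
  have hη0 : 0 < η := lt_min (lt_min hη₁ hη₂) (by positivity)
  have hηω : (2 + p) * η * (2 * Z) ≤ ω / 2 := by
    have h1 : η ≤ ω / (4 * ((2 + p) * (Z + 1))) := min_le_right _ _
    rw [le_div_iff₀ (by positivity)] at h1
    nlinarith [mul_nonneg hη0.le hZ, mul_nonneg (mul_nonneg hp hη0.le) hZ, mul_nonneg hp hη0.le]
  refine ⟨η, hη0, fun n d A Θ Y ζ hA hbd hadm hnoise => ?_⟩
  obtain ⟨hne, hq⟩ := hfirst n d A Θ Y ζ η ((min_le_left _ _).trans (min_le_right _ _)) hbd hadm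
    hnoise
  refine ⟨hne, fun q hqN => ?_⟩
  obtain ⟨hqτ, hq1⟩ := hq q hqN
  have hd := hadm.regular
  have hζS : ζ ∈ A ×ˢ Θ := hadm.mem
  have hζ4 := (hadm.peer_le ζ hζS).trans_lt hb
  have hA0 : A.Nonempty := ⟨_, hζS.1⟩
  have hP1 := d.abs_equilibrium_le hζ4
  constructor
  · intro θ hθ
    obtain ⟨hm, -⟩ := muHat_spec (d := d) hA hA0 Y θ q.2
    have hm2 := (muHat_spec (d := d) hA hA0 Y ζ.2 q.2).2 ζ.1 hζS.1
    set z : Param p := (d.muHat A Y θ q.2, θ) with hz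
    have hzS : z ∈ A ×ˢ Θ := ⟨hm, hθ⟩
    have hz4 : |z.2 0| ≤ 4 := (hadm.peer_le z hzS).trans hb.le
    have h1 := negLogLik_le_add hd hadm.outcome_mem (z := z) (z' := z) (P := d.equilibrium ζ)
      (P' := q.2) hz4 hq1
    have h2 := negLogLik_le_add hd hadm.outcome_mem (z := ζ) (z' := ζ) (P := q.2)
      (P' := d.equilibrium ζ) hζ4.le hP1
    rw [sub_self, norm_zero, mul_zero, zero_add] at h1 h2
    rw [norm_sub_rev] at h1
    have hidx (z' : Param p) (hz' : z' ∈ A ×ˢ Θ) (i : Fin n) :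
        |d.index z' (d.equilibrium ζ) i| ≤ K * Z :=
      (abs_index_le hd hP1 z' i).trans (mul_le_mul_of_nonneg_left (hbd z' hz') hK0.le)
    have h3 := criterion_gap hk (Y := Y) hζ4 (hidx z hzS) (hidx ζ hζS)
    simp only [← index_sub_param] at h3
    have h4 := (abs_le.1 (hnoise.abs_avg_index_le hζS (z - ζ))).2
    have h5 : ‖z - ζ‖ ≤ 2 * Z := by
      linarith [norm_sub_le z ζ, hbd z hzS, hbd ζ hζS]
    have h6 : (2 + p) * η * ‖z - ζ‖ ≤ (2 + p) * η * (2 * Z) := by gcongr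
    have h7 := hgram n d _ Y ζ η ((min_le_left _ _).trans (min_le_left _ _)) hadm hnoise (z - ζ)
    have h8 := sq_avg_abs_le fun i => d.index (z - ζ) (d.equilibrium ζ) i
    have h9 : ‖θ - ζ.2‖ ≤ ‖z - ζ‖ := norm_snd_le (z - ζ)
    have h10 : (γ * ‖θ - ζ.2‖) ^ 2 ≤ avg fun i => d.index (z - ζ) (d.equilibrium ζ) i ^ 2 := by
      refine le_trans ?_ h8
      gcongr
      exact (mul_le_mul_of_nonneg_left h9 hγ.le).trans h7
    have h11 := mul_le_mul_of_nonneg_left h10 hk0.le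
    have h12 : d.profile A Y θ q.2 = d.negLogLik Y z q.2 := rfl
    rw [h12]
    have h13 : k * γ ^ 2 * ‖θ - ζ.2‖ ^ 2 = k * (γ * ‖θ - ζ.2‖) ^ 2 := by ring
    rw [h13]
    linarith
  · intro θ hθ θ' hθ'
    obtain ⟨hm', -⟩ := muHat_spec (d := d) hA hA0 Y θ' q.2
    have h1 := (muHat_spec (d := d) hA hA0 Y θ q.2).2 _ hm'
    have hS : ((d.muHat A Y θ' q.2, θ) : Param p) ∈ A ×ˢ Θ := ⟨hm', hθ⟩
    have h2 := negLogLik_le_add hd hadm.outcome_mem (z := (d.muHat A Y θ' q.2, θ))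
      (z' := (d.muHat A Y θ' q.2, θ')) (P := q.2) (P' := q.2)
      ((hadm.peer_le _ hS).trans hb.le) hq1
    have h3 : ‖((d.muHat A Y θ' q.2, θ) : Param p) - (d.muHat A Y θ' q.2, θ')‖ = ‖θ - θ'‖ := by
      rw [Prod.mk_sub_mk, sub_self, Prod.norm_mk, norm_zero, max_eq_right (norm_nonneg _)]
    rw [h3, sub_self, norm_zero, mul_zero, add_zero, ← mul_assoc] at h2
    exact h1.trans h2

end GroupDesign

/-! ### The C-Lasso step -/

lemma abs_prod_sub_prod_le {ι : Type*} (s : Finset ι) {x y : ι → ℝ} {M : ℝ} (hM : 1 ≤ M)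
    (hx : ∀ i, x i ∈ Set.Icc 0 M) (hy : ∀ i, y i ∈ Set.Icc 0 M) :
    |∏ i ∈ s, x i - ∏ i ∈ s, y i| ≤ M ^ s.card * ∑ i ∈ s, |x i - y i| := by
  classical
  have hM0 : 0 ≤ M := zero_le_one.trans hM
  induction s using Finset.induction_on with
  | empty => simp
  | insert a s ha ih =>
    rw [Finset.prod_insert ha, Finset.prod_insert ha, Finset.sum_insert ha,
      Finset.card_insert_of_notMem ha]
    have e : x a * ∏ i ∈ s, x i - y a * ∏ i ∈ s, y i
        = x a * (∏ i ∈ s, x i - ∏ i ∈ s, y i) + (x a - y a) * ∏ i ∈ s, y i := by ring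
    have h1 : |∏ i ∈ s, y i| ≤ M ^ s.card := by
      rw [Finset.abs_prod]
      calc _ ≤ ∏ _i ∈ s, M := Finset.prod_le_prod (fun _ _ => abs_nonneg _) fun i _ => by
            rw [abs_of_nonneg (hy i).1]; exact (hy i).2
        _ = M ^ s.card := Finset.prod_const _
    have h2 : M ^ s.card ≤ M ^ (s.card + 1) := pow_le_pow_right₀ hM (Nat.le_succ _)
    rw [e]
    refine (abs_add_le _ _).trans ?_
    rw [abs_mul, abs_mul, abs_of_nonneg (hx a).1, mul_add]
    have h3 : x a * |∏ i ∈ s, x i - ∏ i ∈ s, y i|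
        ≤ M ^ (s.card + 1) * ∑ i ∈ s, |x i - y i| := by
      calc _ ≤ M * (M ^ s.card * ∑ i ∈ s, |x i - y i|) :=
            mul_le_mul (hx a).2 ih (abs_nonneg _) hM0
        _ = _ := by ring
    have h4 : |x a - y a| * |∏ i ∈ s, y i| ≤ M ^ (s.card + 1) * |x a - y a| := by
      rw [mul_comm]
      exact mul_le_mul_of_nonneg_right (h1.trans h2) (abs_nonneg _)
    linarith

section CLasso

variable {E : Type*} [NormedAddCommGroup E] {G K : ℕ}

/-- The penalty of one group, `∏_k ‖θ - ϑ_k‖`. -/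
noncomputable def cLassoPenalty (θ : E) (ϑ : Fin K → E) : ℝ := ∏ k, ‖θ - ϑ k‖

lemma cLassoPenalty_nonneg (θ : E) (ϑ : Fin K → E) : 0 ≤ cLassoPenalty θ ϑ :=
  Finset.prod_nonneg fun _ _ => norm_nonneg _

lemma cLassoPenalty_self (ϑ : Fin K → E) (k : Fin K) : cLassoPenalty (ϑ k) ϑ = 0 :=
  Finset.prod_eq_zero (Finset.mem_univ k) (by simp)

lemma abs_cLassoPenalty_sub_le {R : ℝ} (hR : 1 ≤ 2 * R) {θ θ' : E} {ϑ : Fin K → E}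
    (hθ : ‖θ‖ ≤ R) (hθ' : ‖θ'‖ ≤ R) (hϑ : ∀ k, ‖ϑ k‖ ≤ R) :
    |cLassoPenalty θ ϑ - cLassoPenalty θ' ϑ| ≤ (2 * R) ^ K * K * ‖θ - θ'‖ := by
  have h := abs_prod_sub_prod_le (Finset.univ : Finset (Fin K)) hR
    (x := fun k => ‖θ - ϑ k‖) (y := fun k => ‖θ' - ϑ k‖)
    (fun k => ⟨norm_nonneg _, (norm_sub_le _ _).trans (by linarith [hϑ k])⟩)
    (fun k => ⟨norm_nonneg _, (norm_sub_le _ _).trans (by linarith [hϑ k])⟩)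
  refine h.trans ?_
  rw [Finset.card_univ, Fintype.card_fin, mul_assoc]
  refine mul_le_mul_of_nonneg_left ?_ (by positivity)
  have h2 := Finset.sum_le_card_nsmul Finset.univ (fun k : Fin K => |‖θ - ϑ k‖ - ‖θ' - ϑ k‖|)
    ‖θ - θ'‖ fun k _ => by
      refine (abs_norm_sub_norm_le _ _).trans (le_of_eq ?_)
      rw [sub_sub_sub_cancel_right]
  simpa using h2

/-- If the distances of `θ` to the points `ϑ l` have a small product, then one of them is small. -/
lemma exists_norm_sub_lt_of_penalty_lt {s : ℝ} (hs : 0 ≤ s) {θ : E} {ϑ : Fin K → E}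
    (h : cLassoPenalty θ ϑ < s ^ K) : ∃ l, ‖θ - ϑ l‖ < s := by
  by_contra! hc
  have : s ^ K ≤ cLassoPenalty θ ϑ := by
    have := Finset.prod_le_prod (s := (Finset.univ : Finset (Fin K))) (f := fun _ => s)
      (g := fun k => ‖θ - ϑ k‖) (fun _ _ => hs) (fun k _ => hc k)
    simpa [cLassoPenalty] using this
  linarith

/-- A matched family each of whose targets has a member close to it is close to the targets
termwise: distinct targets have distinct close members, which gives a renumbering. -/
lemma norm_sub_le_of_matched {s : ℝ} {ϑ ϑ₀ : Fin K → E}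
    (hsep : ∀ k l, k ≠ l → 2 * s ≤ ‖ϑ₀ k - ϑ₀ l‖)
    (hmatch : ∀ τ : Equiv.Perm (Fin K), ∑ k, ‖ϑ k - ϑ₀ k‖ ≤ ∑ k, ‖ϑ (τ k) - ϑ₀ k‖)
    (hclose : ∀ k, ∃ l, ‖ϑ₀ k - ϑ l‖ < s) (k : Fin K) : ‖ϑ k - ϑ₀ k‖ ≤ K * s := by
  choose f hf using hclose
  have hinj : Function.Injective f := by
    intro k l hkl
    by_contra hne
    have h1 := hsep k l hne
    have h2 := hf k
    have h3 := hf l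
    rw [← hkl, norm_sub_rev] at h3
    have h4 : ‖ϑ₀ k - ϑ₀ l‖ ≤ ‖ϑ₀ k - ϑ (f k)‖ + ‖ϑ (f k) - ϑ₀ l‖ :=
      norm_sub_le_norm_sub_add_norm_sub _ _ _
    linarith
  have h1 := hmatch (Equiv.ofBijective f (Finite.injective_iff_bijective.1 hinj))
  have h2 : ∑ k, ‖ϑ (f k) - ϑ₀ k‖ ≤ K * s := by
    have := Finset.sum_le_card_nsmul Finset.univ (fun k => ‖ϑ (f k) - ϑ₀ k‖) s fun k _ => by
      rw [norm_sub_rev]; exact (hf k).le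
    simpa using this
  have h3 : ‖ϑ k - ϑ₀ k‖ ≤ ∑ k, ‖ϑ k - ϑ₀ k‖ :=
    Finset.single_le_sum (f := fun k => ‖ϑ k - ϑ₀ k‖) (fun _ _ => norm_nonneg _)
      (Finset.mem_univ k)
  exact h3.trans (h1.trans h2)

lemma avg_indicator_eq (κ : Fin G → Fin K) (k : Fin K) (a : ℝ) :
    avg (fun g => if κ g = k then a else 0) = ((trueCluster κ k).ncard : ℝ) / G * a := by
  have h : (trueCluster κ k).ncard = (Finset.univ.filter fun g => κ g = k).card := by
    rw [← Set.ncard_coe_finset]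
    congr 1
    ext g
    simp [trueCluster]
  rw [h, avg, ← Finset.sum_filter, Finset.sum_const, nsmul_eq_mul]
  ring

lemma exists_separation {ϑ₀ : Fin K → E} (hinj : Function.Injective ϑ₀) :
    ∃ Δ > 0, ∀ k l, k ≠ l → Δ ≤ ‖ϑ₀ k - ϑ₀ l‖ := by
  rcases isEmpty_or_nonempty (Fin K) with hK | hK
  · exact ⟨1, one_pos, fun k => isEmptyElim k⟩
  obtain ⟨q, hq⟩ := Finite.exists_min fun q : Fin K × Fin K =>
    if q.1 = q.2 then (1 : ℝ) else min 1 ‖ϑ₀ q.1 - ϑ₀ q.2‖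
  refine ⟨if q.1 = q.2 then (1 : ℝ) else min 1 ‖ϑ₀ q.1 - ϑ₀ q.2‖, ?_, fun k l hkl => ?_⟩
  · split_ifs with h
    · exact one_pos
    · exact lt_min one_pos (norm_pos_iff.2 (sub_ne_zero.2 (hinj.ne h)))
  · have := hq (k, l)
    simp only [if_neg hkl] at this
    exact this.trans (min_le_right _ _)

/-- Minimizers of a penalized average of group criteria. If every criterion `Q g` is Lipschitz and
separates slopes quadratically from the true slope, up to a small error `ω`, then all group
estimates and all matched cluster estimates are close to the true values. Only positivity of the
penalty weight matters. -/
lemma exists_cLasso_bound {R a Λ π s : ℝ} {ϑ₀ : Fin K → E} (Θ : Set E) (hΘ : ∀ θ ∈ Θ, ‖θ‖ ≤ R)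
    (hϑ₀ : ∀ k, ϑ₀ k ∈ Θ) (hinj : Function.Injective ϑ₀) (ha : 0 < a) (hΛ : 0 ≤ Λ) (hπ : 0 < π)
    (hs : 0 < s) :
    ∃ ω > 0, ∀ (G : ℕ) (κ : Fin G → Fin K) (Q : Fin G → E → ℝ) (ρ : ℝ)
      (θ : Fin G → E) (ϑ : Fin K → E), 0 < G → 0 < ρ →
      (∀ k, π ≤ ((trueCluster κ k).ncard : ℝ) / G) →
      (∀ g, ∀ θ ∈ Θ, a * ‖θ - ϑ₀ (κ g)‖ ^ 2 ≤ Q g θ - Q g (ϑ₀ (κ g)) + ω) →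
      (∀ g, ∀ θ ∈ Θ, ∀ θ' ∈ Θ, Q g θ ≤ Q g θ' + Λ * ‖θ - θ'‖) →
      (∀ g, θ g ∈ Θ) → (∀ k, ϑ k ∈ Θ) →
      (∀ (θ' : Fin G → E) (ϑ' : Fin K → E), (∀ g, θ' g ∈ Θ) → (∀ k, ϑ' k ∈ Θ) →
        avg (fun g => Q g (θ g) + ρ * cLassoPenalty (θ g) ϑ)
          ≤ avg fun g => Q g (θ' g) + ρ * cLassoPenalty (θ' g) ϑ') →
      (∀ τ : Equiv.Perm (Fin K), ∑ k, ‖ϑ k - ϑ₀ k‖ ≤ ∑ k, ‖ϑ (τ k) - ϑ₀ k‖) →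
      (∀ g, ‖θ g - ϑ₀ (κ g)‖ ≤ s) ∧ ∀ k, ‖ϑ k - ϑ₀ k‖ ≤ s := by
  obtain ⟨Δ, hΔ0, hΔ⟩ := exists_separation hinj
  set R' := max R 1 with hR'
  have hR1 : 1 ≤ R' := le_max_right _ _
  have hΘ' : ∀ θ ∈ Θ, ‖θ‖ ≤ R' := fun θ h => (hΘ θ h).trans (le_max_left _ _)
  have h2R : 1 ≤ 2 * R' := by linarith
  set B : ℝ := (2 * R') ^ K * K with hB
  have hB0 : 0 ≤ B := by positivity
  -- `s₁` is the accuracy of the cluster estimates before they are matched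
  set s₁ := min (Δ / 2) (min (s / (K + 1)) (a * s ^ 2 / (2 * (Λ * K + 1)))) with hs₁
  have hs₁0 : 0 < s₁ := lt_min (by positivity) (lt_min (by positivity) (by positivity))
  have hs₁s : K * s₁ ≤ s := by
    have h1 : s₁ ≤ s / (K + 1) := (min_le_right _ _).trans (min_le_left _ _)
    rw [le_div_iff₀ (by positivity)] at h1
    nlinarith
  have hs₁Λ : Λ * (K * s₁) ≤ a * s ^ 2 / 2 := by
    have h1 : s₁ ≤ a * s ^ 2 / (2 * (Λ * K + 1)) := (min_le_right _ _).trans (min_le_right _ _)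
    rw [le_div_iff₀ (by positivity)] at h1
    nlinarith
  -- `m` bounds the mean distance of the group estimates from the true slopes
  set m := min (s / 2) (π * s₁ ^ K / (2 * (2 * B + 1))) with hm
  have hm0 : 0 < m := lt_min (by positivity) (by positivity)
  have hmB : 2 * B * m < π * s₁ ^ K := by
    have h1 : m ≤ π * s₁ ^ K / (2 * (2 * B + 1)) := min_le_right _ _
    rw [le_div_iff₀ (by positivity)] at h1
    have : 0 < π * s₁ ^ K := by positivity
    nlinarith
  have hms : a * m ^ 2 ≤ a * s ^ 2 / 2 := by
    have h1 : m ^ 2 ≤ (s / 2) ^ 2 := pow_le_pow_left₀ hm0.le (min_le_left _ _) 2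
    nlinarith [mul_le_mul_of_nonneg_left h1 ha.le, mul_pos ha (pow_pos hs 2)]
  refine ⟨a * m ^ 2, by positivity,
    fun G κ Q ρ θ ϑ hG hρ hfrac hsep hlip hθ hϑ hmin hmatch => ?_⟩
  have hG0 : (0 : ℝ) < G := by exact_mod_cast hG
  -- comparison with the true values, which have no penalty
  have h1 : avg (fun g => ‖θ g - ϑ₀ (κ g)‖) ≤ m := by
    have h2 := hmin (fun g => ϑ₀ (κ g)) ϑ₀ (fun g => hϑ₀ _) hϑ₀
    simp only [cLassoPenalty_self, mul_zero, add_zero] at h2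
    have h3 : avg (fun g => a * ‖θ g - ϑ₀ (κ g)‖ ^ 2 - a * m ^ 2)
        ≤ avg (fun g => (Q g (θ g) + ρ * cLassoPenalty (θ g) ϑ) - Q g (ϑ₀ (κ g))) := by
      refine avg_mono fun g => ?_
      have := hsep g (θ g) (hθ g)
      have := mul_nonneg hρ.le (cLassoPenalty_nonneg (θ g) ϑ)
      linarith
    rw [avg_sub, avg_sub, avg_const_mul] at h3
    have h4 : avg (fun _ : Fin G => a * m ^ 2) ≤ a * m ^ 2 :=
      avg_le_of_forall_le (by positivity) fun _ => le_rfl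
    have h5 := sq_avg_abs_le fun g => ‖θ g - ϑ₀ (κ g)‖
    simp only [abs_norm] at h5
    have h6 : a * avg (fun g => ‖θ g - ϑ₀ (κ g)‖) ^ 2 ≤ a * m ^ 2 := by
      have := mul_le_mul_of_nonneg_left h5 ha.le
      linarith
    exact le_of_sq_le_sq (le_of_mul_le_mul_left h6 ha) hm0.le
  -- given the group estimates, the cluster estimates minimize the total penalty
  have h2 : avg (fun g => cLassoPenalty (θ g) ϑ) ≤ avg (fun g => cLassoPenalty (θ g) ϑ₀) := by
    have h3 := hmin θ ϑ₀ hθ hϑ₀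
    rw [avg_add, avg_add, avg_const_mul, avg_const_mul] at h3
    exact le_of_mul_le_mul_left (by linarith) hρ
  have h3 : avg (fun g => cLassoPenalty (ϑ₀ (κ g)) ϑ) ≤ 2 * B * m := by
    have h4 : avg (fun g => cLassoPenalty (ϑ₀ (κ g)) ϑ)
        ≤ avg (fun g => cLassoPenalty (θ g) ϑ + B * ‖θ g - ϑ₀ (κ g)‖) := by
      refine avg_mono fun g => ?_
      have := (abs_le.1 (abs_cLassoPenalty_sub_le h2R (hΘ' _ (hθ g)) (hΘ' _ (hϑ₀ (κ g)))
        fun k => hΘ' _ (hϑ k))).1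
      linarith
    have h5 : avg (fun g => cLassoPenalty (θ g) ϑ₀) ≤ avg (fun g => B * ‖θ g - ϑ₀ (κ g)‖) := by
      refine avg_mono fun g => ?_
      have := (abs_le.1 (abs_cLassoPenalty_sub_le h2R (hΘ' _ (hθ g)) (hΘ' _ (hϑ₀ (κ g)))
        fun k => hΘ' _ (hϑ₀ k))).2
      rw [cLassoPenalty_self] at this
      linarith
    rw [avg_add, avg_const_mul] at h4
    rw [avg_const_mul] at h5
    have := mul_le_mul_of_nonneg_left h1 hB0
    linarith
  have hϑs (k : Fin K) : ‖ϑ k - ϑ₀ k‖ ≤ K * s₁ := by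
    refine norm_sub_le_of_matched (fun k l hkl => ?_) hmatch (fun k => ?_) k
    · have h4 : s₁ ≤ Δ / 2 := min_le_left _ _
      linarith [hΔ k l hkl]
    · refine exists_norm_sub_lt_of_penalty_lt hs₁0.le ?_
      have h4 : avg (fun g => if κ g = k then cLassoPenalty (ϑ₀ k) ϑ else 0)
          ≤ avg (fun g => cLassoPenalty (ϑ₀ (κ g)) ϑ) := by
        refine avg_mono fun g => ?_
        split_ifs with h
        · rw [h]
        · exact cLassoPenalty_nonneg _ _
      rw [avg_indicator_eq] at h4
      have h5 := mul_le_mul_of_nonneg_right (hfrac k) (cLassoPenalty_nonneg (ϑ₀ k) ϑ)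
      exact lt_of_mul_lt_mul_left (by linarith) hπ.le
  refine ⟨fun g => ?_, fun k => (hϑs k).trans hs₁s⟩
  -- comparison with the cluster estimate of the own cluster, which has no penalty either
  have h4 : Q g (θ g) ≤ Q g (ϑ (κ g)) := by
    classical
    have h5 := hmin (Function.update θ g (ϑ (κ g))) ϑ (fun g' => by
      by_cases h : g' = g
      · subst h; simpa using hϑ _
      · simpa [h] using hθ g') hϑ
    rw [← sub_nonneg, ← avg_sub, avg, Finset.sum_eq_single g (fun g' _ h => by simp [h])
      (fun h => absurd (Finset.mem_univ g) h), Function.update_self, cLassoPenalty_self] at h5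
    have h6 := nonneg_of_mul_nonneg_right h5 (by positivity)
    have := mul_nonneg hρ.le (cLassoPenalty_nonneg (θ g) ϑ)
    linarith
  have h5 := hsep g (θ g) (hθ g)
  have h6 := hlip g _ (hϑ (κ g)) _ (hϑ₀ (κ g))
  have h7 := mul_le_mul_of_nonneg_left (hϑs (κ g)) hΛ
  have h8 : a * ‖θ g - ϑ₀ (κ g)‖ ^ 2 ≤ a * s ^ 2 := by linarith
  exact le_of_sq_le_sq (le_of_mul_le_mul_left h8 ha) hs.le

end CLasso

lemma cLassoObjective_eq {n p G K : ℕ} (A : Set ℝ) (ρ : ℝ) (d : Fin G → GroupDesign n p)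
    (Y P : Fin G → Fin n → ℝ) (θ : Fin G → Slope p) (ϑ : Fin K → Slope p) :
    cLassoObjective A ρ d Y P θ ϑ
      = avg fun g => (d g).profile A (Y g) (θ g) (P g) + ρ * cLassoPenalty (θ g) ϑ := by
  rw [avg_add, avg_const_mul]
  simp only [cLassoObjective, avg, cLassoPenalty]
  ring

lemma estCluster_eq_trueCluster {p G K : ℕ} {κ : Fin G → Fin K} {θ : Fin G → Slope p}
    {ϑ ϑ₀ : Fin K → Slope p} {s : ℝ} (hsep : ∀ k l, k ≠ l → 4 * s < ‖ϑ₀ k - ϑ₀ l‖)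
    (hθ : ∀ g, ‖θ g - ϑ₀ (κ g)‖ ≤ s) (hϑ : ∀ k, ‖ϑ k - ϑ₀ k‖ ≤ s) (k : Fin K) :
    estCluster θ ϑ k = trueCluster κ k := by
  have key (g : Fin G) (l : Fin K) (hl : l ≠ κ g) : ‖θ g - ϑ (κ g)‖ < ‖θ g - ϑ l‖ := by
    have h1 : ‖θ g - ϑ (κ g)‖ ≤ ‖θ g - ϑ₀ (κ g)‖ + ‖ϑ₀ (κ g) - ϑ (κ g)‖ :=
      norm_sub_le_norm_sub_add_norm_sub _ _ _
    have h2 : ‖ϑ₀ (κ g) - ϑ₀ l‖ ≤ ‖ϑ₀ (κ g) - θ g‖ + (‖θ g - ϑ l‖ + ‖ϑ l - ϑ₀ l‖) :=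
      (norm_sub_le_norm_sub_add_norm_sub _ (θ g) _).trans
        (add_le_add le_rfl (norm_sub_le_norm_sub_add_norm_sub _ _ _))
    rw [norm_sub_rev (ϑ₀ (κ g)) (ϑ (κ g))] at h1
    rw [norm_sub_rev (ϑ₀ (κ g)) (θ g)] at h2
    linarith [hsep (κ g) l hl.symm, hθ g, hϑ (κ g), hϑ l]
  ext g
  constructor
  · intro hg
    by_contra hne
    have hne' : κ g ≠ k := hne
    exact lt_asymm (hg (κ g) hne') (key g k hne'.symm)
  · rintro rfl l hl
    exact key g l hl

/-! ### Concentration of the prediction errors -/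

section Concentration

variable {Ω : Type*} [MeasurableSpace Ω] {μ : Measure Ω}

lemma IsStdLogistic.measure_lt {ε : Ω → ℝ} (h : IsStdLogistic μ ε) (x : ℝ) :
    μ {ω | ε ω < x} = ENNReal.ofReal (Real.sigmoid x) := by
  refine le_antisymm ?_ ?_
  · rw [← h x]
    exact measure_mono fun ω (hω : ε ω < x) => hω.le
  · have hc : Tendsto (fun y => ENNReal.ofReal (Real.sigmoid y)) (𝓝[<] x)
        (𝓝 (ENNReal.ofReal (Real.sigmoid x))) :=
      (ENNReal.continuous_ofReal.comp continuous_sigmoid).continuousAt.tendsto.mono_left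
        nhdsWithin_le_nhds
    refine le_of_tendsto hc ?_
    filter_upwards [self_mem_nhdsWithin] with y hy
    rw [← h y]
    exact measure_mono fun ω (hω : ε ω ≤ y) => hω.trans_lt hy

/-- The error in predicting the outcome `1{x > ε}` by its success probability has mean zero. -/
lemma integral_outcome_sub_eq_zero [IsProbabilityMeasure μ] {ε : Ω → ℝ} (hm : Measurable ε)
    (h : IsStdLogistic μ ε) (x w : ℝ) :
    ∫ ω, ((if x > ε ω then 1 else 0) - Real.sigmoid x) * w ∂μ = 0 := by
  have hs : MeasurableSet {ω | ε ω < x} := measurableSet_lt hm measurable_const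
  have e : (fun ω => if x > ε ω then (1 : ℝ) else 0)
      = Set.indicator {ω | ε ω < x} fun _ => (1 : ℝ) := by
    ext ω
    simp [Set.indicator_apply]
  have hi : Integrable (fun ω => if x > ε ω then (1 : ℝ) else 0) μ := by
    rw [e]
    exact (integrable_const 1).indicator hs
  rw [integral_mul_const, integral_sub hi (integrable_const _), e, integral_indicator hs]
  simp [Measure.real, h.measure_lt, ENNReal.toReal_ofReal (Real.sigmoid_nonneg x)]

lemma abs_indicator_sub_sigmoid_le (x e : ℝ) :
    |(if x > e then (1 : ℝ) else 0) - Real.sigmoid x| ≤ 1 := by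
  have h0 := Real.sigmoid_pos x
  have h1 := Real.sigmoid_lt_one x
  rw [abs_le]
  split_ifs <;> constructor <;> linarith

/-- Hoeffding's inequality for weighted prediction errors, one-sided. -/
lemma measureReal_le_sum_le [IsProbabilityMeasure μ] {n : ℕ} {ε : Fin n → Ω → ℝ}
    (hm : ∀ i, Measurable (ε i)) (hlaw : ∀ i, IsStdLogistic μ (ε i)) (hind : iIndepFun ε μ)
    (x w : Fin n → ℝ) {B t : ℝ} (hB : 0 < B) (hw : ∀ i, |w i| ≤ B) (ht : 0 ≤ t) :
    μ.real {ω | n * t ≤ ∑ i, ((if x i > ε i ω then 1 else 0) - Real.sigmoid (x i)) * w i}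
      ≤ Real.exp (-(t ^ 2 / (2 * B ^ 2)) * n) := by
  have hmeas (i : Fin n) : Measurable fun e : ℝ =>
      ((if x i > e then (1 : ℝ) else 0) - Real.sigmoid (x i)) * w i :=
    ((Measurable.ite (measurableSet_lt measurable_id measurable_const) measurable_const
      measurable_const).sub_const _).mul_const _
  have hind' := hind.comp _ hmeas
  have hsub (i : Fin n) : HasSubgaussianMGF
      ((fun e : ℝ => ((if x i > e then (1 : ℝ) else 0) - Real.sigmoid (x i)) * w i) ∘ ε i)
      ((‖B - (-B)‖₊ / 2) ^ 2) μ := by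
    refine hasSubgaussianMGF_of_mem_Icc_of_integral_eq_zero
      ((hmeas i).comp (hm i)).aemeasurable (.of_forall fun ω => ?_)
      (integral_outcome_sub_eq_zero (hm i) (hlaw i) (x i) (w i))
    rw [Set.mem_Icc, ← abs_le, Function.comp_apply, abs_mul]
    calc _ ≤ 1 * B := mul_le_mul (abs_indicator_sub_sigmoid_le _ _) (hw i) (abs_nonneg _) zero_le_one
      _ = B := one_mul B
  have h := HasSubgaussianMGF.measure_sum_ge_le_of_iIndepFun hind' (s := Finset.univ)
    (fun i _ => hsub i) (ε := n * t) (by positivity)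
  refine h.trans (Real.exp_le_exp.2 (le_of_eq ?_))
  have hBn : ((‖B - (-B)‖₊ : ℝ) / 2) = B := by
    rw [coe_nnnorm, Real.norm_of_nonneg (by linarith)]; ring
  simp only [Finset.sum_const, Finset.card_univ, Fintype.card_fin, nsmul_eq_mul, NNReal.coe_mul,
    NNReal.coe_natCast, NNReal.coe_pow, NNReal.coe_div, NNReal.coe_ofNat]
  rw [hBn]
  rcases Nat.eq_zero_or_pos n with rfl | hn
  · simp
  · have : (n : ℝ) ≠ 0 := by positivity
    field_simp

lemma measure_lt_abs_avg_le [IsProbabilityMeasure μ] {n : ℕ} {ε : Fin n → Ω → ℝ}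
    (hm : ∀ i, Measurable (ε i)) (hlaw : ∀ i, IsStdLogistic μ (ε i)) (hind : iIndepFun ε μ)
    (x w : Fin n → ℝ) {B t : ℝ} (hB : 0 < B) (hw : ∀ i, |w i| ≤ B) (ht : 0 ≤ t) :
    μ {ω | t < |avg fun i => ((if x i > ε i ω then 1 else 0) - Real.sigmoid (x i)) * w i|}
      ≤ ENNReal.ofReal (2 * Real.exp (-(t ^ 2 / (2 * B ^ 2)) * n)) := by
  have h1 := measureReal_le_sum_le hm hlaw hind x w hB hw ht
  have h2 := measureReal_le_sum_le hm hlaw hind x (fun i => -w i) hB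
    (fun i => by rw [abs_neg]; exact hw i) ht
  have hsub : {ω | t < |avg fun i => ((if x i > ε i ω then 1 else 0) - Real.sigmoid (x i)) * w i|}
      ⊆ {ω | n * t ≤ ∑ i, ((if x i > ε i ω then 1 else 0) - Real.sigmoid (x i)) * w i}
        ∪ {ω | n * t ≤ ∑ i, ((if x i > ε i ω then 1 else 0) - Real.sigmoid (x i)) * -w i} := by
    intro ω hω
    rw [Set.mem_ofPred_eq, avg, one_div, inv_mul_eq_div] at hω
    have hn : (0 : ℝ) < n := by
      rcases Nat.eq_zero_or_pos n with rfl | hn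
      · simp only [Nat.cast_zero, div_zero, abs_zero] at hω
        exact absurd hω ht.not_gt
      · exact_mod_cast hn
    rw [lt_abs, ← neg_div, lt_div_iff₀' hn, lt_div_iff₀' hn, ← Finset.sum_neg_distrib] at hω
    simp only [← mul_neg] at hω
    exact hω.imp le_of_lt le_of_lt
  rw [two_mul, ENNReal.ofReal_add (by positivity) (by positivity)]
  refine (measure_mono hsub).trans ((measure_union_le _ _).trans (add_le_add ?_ ?_))
  · rw [← ofReal_measureReal]
    exact ENNReal.ofReal_le_ofReal h1
  · rw [← ofReal_measureReal]
    exact ENNReal.ofReal_le_ofReal h2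

/-- Conditioning on an independent variable: a bound for every fixed value of `D` is a bound for
the random one. -/
lemma measure_preimage_le_of_indepFun [IsProbabilityMeasure μ] {α β : Type*} [MeasurableSpace α]
    [MeasurableSpace β] {D : Ω → α} {e : Ω → β} (hD : Measurable D) (he : Measurable e)
    (hind : IndepFun D e μ) {B : Set (α × β)} (hB : MeasurableSet B) {t : ENNReal}
    (h : ∀ a, μ {ω | (a, e ω) ∈ B} ≤ t) : μ {ω | (D ω, e ω) ∈ B} ≤ t := by
  have h1 := (indepFun_iff_map_prod_eq_prod_map_map hD.aemeasurable he.aemeasurable).1 hind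
  have hpD : IsProbabilityMeasure (μ.map D) := Measure.isProbabilityMeasure_map hD.aemeasurable
  have hpe : IsProbabilityMeasure (μ.map e) := Measure.isProbabilityMeasure_map he.aemeasurable
  have h2 : μ {ω | (D ω, e ω) ∈ B} = (μ.map fun ω => (D ω, e ω)) B :=
    (Measure.map_apply (hD.prodMk he) hB).symm
  rw [h2, h1, Measure.prod_apply hB]
  calc ∫⁻ a, (μ.map e) (Prod.mk a ⁻¹' B) ∂(μ.map D) ≤ ∫⁻ _, t ∂(μ.map D) := by
        refine lintegral_mono fun a => ?_
        rw [Measure.map_apply he (measurable_prodMk_left hB)]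
        exact h a
    _ = t := by simp

end Concentration

namespace GroupDesign

variable {n p : ℕ}

/-- Designs carry the σ-algebra generated by the covariates and the friendship matrix. -/
instance : MeasurableSpace (GroupDesign n p) :=
  MeasurableSpace.comap (fun d => (d.X, d.F)) inferInstance

lemma measurable_data : Measurable fun d : GroupDesign n p => (d.X, d.F) :=
  comap_measurable _

lemma measurable_X (i : Fin n) (k : Fin p) : Measurable fun d : GroupDesign n p => d.X i k :=
  (measurable_pi_apply k).comp ((measurable_pi_apply i).comp measurable_data.fst)

lemma measurable_F (i j : Fin n) : Measurable fun d : GroupDesign n p => d.F i j :=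
  (measurable_pi_apply j).comp ((measurable_pi_apply i).comp measurable_data.snd)

lemma measurable_peerMean {P : GroupDesign n p → Fin n → ℝ} (hP : ∀ i, Measurable fun d => P d i)
    (i : Fin n) : Measurable fun d : GroupDesign n p => d.peerMean (P d) i := by
  have hF (j : Fin n) : MeasurableSet {d : GroupDesign n p | d.F i j = true} :=
    measurable_F i j (measurableSet_singleton true)
  have e : (fun d : GroupDesign n p => d.peerMean (P d) i)
      = fun d => (∑ j, if d.F i j = true then (1 : ℝ) else 0)⁻¹
        * ∑ j, if d.F i j = true then P d j else 0 := by
    ext d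
    rw [peerMean, friends, Finset.sum_filter, Finset.card_filter]
    push_cast
    rfl
  rw [e]
  exact (Finset.measurable_sum _ fun j _ =>
    Measurable.ite (hF j) measurable_const measurable_const).inv.mul
    (Finset.measurable_sum _ fun j _ => Measurable.ite (hF j) (hP j) measurable_const)

lemma measurable_index (ζ : Param p) {P : GroupDesign n p → Fin n → ℝ}
    (hP : ∀ i, Measurable fun d => P d i) (i : Fin n) :
    Measurable fun d : GroupDesign n p => d.index ζ (P d) i :=
  (((measurable_peerMean hP i).mul_const _).add
    (Finset.measurable_sum _ fun k _ => (measurable_X i k).mul_const _)).add_const _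

/-- The equilibrium is a limit of iterated best responses, hence measurable in the design. -/
lemma measurable_equilibrium {ζ : Param p} (hζ : |ζ.2 0| < 4) (i : Fin n) :
    Measurable fun d : GroupDesign n p => d.equilibrium ζ i := by
  have h (m : ℕ) : ∀ i, Measurable fun d : GroupDesign n p => (d.bestResponse ζ)^[m] 0 i := by
    induction m with
    | zero => exact fun i => measurable_const
    | succ m ih =>
      intro i
      simp only [Function.iterate_succ_apply']
      exact continuous_sigmoid.measurable.comp (measurable_index ζ ih i)
  refine measurable_of_tendsto_metrizable (fun m => h m i) ?_
  rw [tendsto_pi_nhds]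
  exact fun d => (tendsto_pi_nhds.1 (d.tendsto_iterate_bestResponse hζ)) i

lemma outcome_mem_Icc (d : GroupDesign n p) (ζ : Param p) (e : Fin n → ℝ) (i : Fin n) :
    d.outcome ζ e i ∈ Set.Icc (0 : ℝ) 1 := by
  unfold outcome
  split_ifs <;> simp

/-- For one group, an average of prediction errors with weights that are functions of the public
information exceeds `t` with exponentially small probability. -/
lemma measure_noise_le {Ω : Type*} [MeasurableSpace Ω] {μ : Measure Ω} [IsProbabilityMeasure μ]
    {D : Ω → GroupDesign n p} (hD : Measurable D) {ε : Fin n → Ω → ℝ}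
    (hm : ∀ i, Measurable (ε i)) (hlaw : ∀ i, IsStdLogistic μ (ε i)) (hind : iIndepFun ε μ)
    (hDε : IndepFun D (fun ω i => ε i ω) μ) {ζ : Param p} (hζ : |ζ.2 0| < 4)
    {w : GroupDesign n p → Fin n → ℝ} (hwm : ∀ i, Measurable fun d => w d i)
    {B t : ℝ} (hB : 0 < B) (hw : ∀ d i, |w d i| ≤ B) (ht : 0 ≤ t) :
    μ {ω | t < |avg fun i => ((D ω).outcome ζ (fun i => ε i ω) i - (D ω).equilibrium ζ i)
        * w (D ω) i|} ≤ ENNReal.ofReal (2 * Real.exp (-(t ^ 2 / (2 * B ^ 2)) * n)) := by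
  have hx (i : Fin n) : Measurable fun d : GroupDesign n p => d.index ζ (d.equilibrium ζ) i :=
    measurable_index ζ (fun i => measurable_equilibrium hζ i) i
  set S : Set (GroupDesign n p × (Fin n → ℝ)) := {q | t < |avg fun i =>
    ((if q.1.index ζ (q.1.equilibrium ζ) i > q.2 i then (1 : ℝ) else 0)
      - Real.sigmoid (q.1.index ζ (q.1.equilibrium ζ) i)) * w q.1 i|} with hS
  have hSm : MeasurableSet S := by
    refine measurableSet_lt measurable_const (Measurable.abs ?_)
    refine Measurable.const_mul (Finset.measurable_sum _ fun i _ => ?_) _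
    refine Measurable.mul (Measurable.sub (Measurable.ite ?_ measurable_const measurable_const)
      (continuous_sigmoid.measurable.comp ((hx i).comp measurable_fst)))
      ((hwm i).comp measurable_fst)
    exact measurableSet_lt ((measurable_pi_apply i).comp measurable_snd)
      ((hx i).comp measurable_fst)
  have h := measure_preimage_le_of_indepFun hD (measurable_pi_lambda _ hm) hDε hSm fun d =>
    measure_lt_abs_avg_le hm hlaw hind (d.index ζ (d.equilibrium ζ)) (w d) hB (hw d) ht
  refine (measure_mono fun ω hω => ?_).trans h
  rw [Set.mem_ofPred_eq] at hω
  change t < |avg fun i => _|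
  convert hω using 5
  rw [← (D _).equilibrium_apply hζ]
  unfold outcome
  congr 1

end GroupDesign

/-! ### Events that hold with probability approaching one -/

section WPA1

variable {Ω : Type*} [MeasurableSpace Ω] {μ : Measure Ω}

lemma WPA1.mono {E F : ℕ → Set Ω} (h : WPA1 μ E) (hEF : ∀ᶠ n in atTop, E n ⊆ F n) : WPA1 μ F :=
  tendsto_of_tendsto_of_tendsto_of_le_of_le' tendsto_const_nhds h
    (.of_forall fun _ => zero_le)
    (hEF.mono fun _ hn => measure_mono (Set.compl_subset_compl.2 hn))

lemma WPA1.inter {E F : ℕ → Set Ω} (hE : WPA1 μ E) (hF : WPA1 μ F) :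
    WPA1 μ fun n => E n ∩ F n := by
  have h : Tendsto (fun n => μ (E n)ᶜ + μ (F n)ᶜ) atTop (𝓝 0) := by simpa using hE.add hF
  refine tendsto_of_tendsto_of_tendsto_of_le_of_le tendsto_const_nhds h
    (fun _ => zero_le) fun n => ?_
  rw [Set.compl_inter]
  exact measure_union_le _ _

lemma WPA1.of_ae {E : ℕ → Set Ω} (h : ∀ n, ∀ᵐ ω ∂μ, ω ∈ E n) : WPA1 μ E := by
  have : ∀ n, μ (E n)ᶜ = 0 := fun n => h n
  simp [WPA1, this]

lemma WPA1.forall_mem {ι : Type*} (s : Finset ι) {E : ι → ℕ → Set Ω}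
    (h : ∀ i ∈ s, WPA1 μ (E i)) : WPA1 μ fun n => {ω | ∀ i ∈ s, ω ∈ E i n} := by
  classical
  induction s using Finset.induction_on with
  | empty => exact WPA1.of_ae fun n => .of_forall fun ω => by simp
  | insert a s ha ih =>
    refine ((h a (Finset.mem_insert_self _ _)).inter
      (ih fun i hi => h i (Finset.mem_insert_of_mem hi))).mono (.of_forall fun n ω hω i hi => ?_)
    rcases Finset.mem_insert.1 hi with rfl | hi
    · exact hω.1
    · exact hω.2 i hi

/-- A union over `O(n)` groups of events of exponentially small probability is negligible. -/
lemma WPA1.of_exp_bound {G : ℕ → ℕ} {c : ℝ} (hG : Tendsto (fun n => (G n : ℝ) / n) atTop (𝓝 c))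
    {E : ∀ n, Fin (G n) → Set Ω} {a : ℝ} (ha : 0 < a)
    (h : ∀ n g, μ (E n g)ᶜ ≤ ENNReal.ofReal (2 * Real.exp (-a * n))) :
    WPA1 μ fun n => {ω | ∀ g, ω ∈ E n g} := by
  have h1 (n : ℕ) : μ {ω | ∀ g, ω ∈ E n g}ᶜ
      ≤ ENNReal.ofReal (G n * (2 * Real.exp (-a * n))) := by
    have e : {ω | ∀ g, ω ∈ E n g}ᶜ = ⋃ g, (E n g)ᶜ := by
      ext ω; simp
    rw [e]
    refine (measure_iUnion_fintype_le _ _).trans ((Finset.sum_le_sum fun g _ => h n g).trans ?_)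
    rw [Finset.sum_const, Finset.card_univ, Fintype.card_fin, nsmul_eq_mul,
      ENNReal.ofReal_mul (Nat.cast_nonneg _), ENNReal.ofReal_natCast]
  have h2 : Tendsto (fun n : ℕ => (n : ℝ) * Real.exp (-a * n)) atTop (𝓝 0) := by
    have := (Real.tendsto_pow_mul_exp_neg_atTop_nhds_zero 1).comp
      (tendsto_natCast_atTop_atTop.const_mul_atTop ha)
    have h3 := this.const_mul a⁻¹
    rw [mul_zero] at h3
    refine h3.congr fun n => ?_
    simp only [Function.comp_apply, pow_one]
    field_simp
  have h3 : Tendsto (fun n : ℕ => (G n : ℝ) / n * (2 * ((n : ℝ) * Real.exp (-a * n)))) atTop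
      (𝓝 0) := by simpa using hG.mul (h2.const_mul 2)
  have h4 : Tendsto (fun n : ℕ => ENNReal.ofReal (G n * (2 * Real.exp (-a * n)))) atTop
      (𝓝 0) := by
    rw [← ENNReal.ofReal_zero]
    refine (ENNReal.continuous_ofReal.tendsto 0).comp (h3.congr' ?_)
    filter_upwards [eventually_gt_atTop 0] with n hn
    have : (n : ℝ) ≠ 0 := by positivity
    field_simp
  exact tendsto_of_tendsto_of_tendsto_of_le_of_le tendsto_const_nhds h4 (fun _ => zero_le) h1

end WPA1

/-! ### Uniform control of the noise -/

namespace GroupDesign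

variable {p : ℕ}

/-- Uniformity over the parameter space: by the Lipschitz continuity of the equilibrium, it is
enough to control the noise on a finite net. -/
lemma noiseLE_of_net {n : ℕ} {d : GroupDesign n p} {C b r η : ℝ} (hd : d.Regular C) (hb : b < 4)
    {S : Set (Param p)} (hS : ∀ z ∈ S, |z.2 0| ≤ b) {ζ : Param p} (hζ : |ζ.2 0| ≤ b)
    {Y : Fin n → ℝ} (hY : ∀ i, Y i ∈ Set.Icc (0 : ℝ) 1) {N : Set (Param p)} (hNS : N ⊆ S)
    (hN : S ⊆ ⋃ z ∈ N, Metric.ball z r) (hr : lipConst p C b * r ≤ η / 2) (hη : 0 ≤ η)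
    (h1 : |avg fun i => Y i - d.equilibrium ζ i| ≤ η)
    (h2 : ∀ k, |avg fun i => (Y i - d.equilibrium ζ i) * d.X i k| ≤ η)
    (h3 : ∀ z ∈ N, |avg fun i => (Y i - d.equilibrium ζ i) * d.peerMean (d.equilibrium z) i|
      ≤ η / 2) :
    d.NoiseLE Y (d.equilibrium ζ) S η := by
  refine ⟨h1, h2, fun z hz => ?_⟩
  obtain ⟨z', hz', hzz'⟩ := Set.mem_iUnion₂.1 (hN hz)
  have hdist : ‖z - z'‖ ≤ r := by
    rw [← dist_eq_norm]
    exact (Metric.mem_ball.1 hzz').le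
  have hL := lipConst_nonneg (p := p) hd.nonneg hb
  have hP : ‖d.equilibrium z - d.equilibrium z'‖ ≤ η / 2 :=
    (norm_equilibrium_sub_le hd hb (hS z hz) (hS z' (hNS hz'))).trans
      ((mul_le_mul_of_nonneg_left hdist hL).trans hr)
  have e : (avg fun i => (Y i - d.equilibrium ζ i) * d.peerMean (d.equilibrium z) i)
      = (avg fun i => (Y i - d.equilibrium ζ i) * d.peerMean (d.equilibrium z') i)
        + avg fun i => (Y i - d.equilibrium ζ i)
          * d.peerMean (d.equilibrium z - d.equilibrium z') i := by
    rw [← avg_add]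
    refine congrArg avg (funext fun i => ?_)
    rw [peerMean_sub]
    ring
  have h4 : |avg fun i => (Y i - d.equilibrium ζ i)
      * d.peerMean (d.equilibrium z - d.equilibrium z') i| ≤ η / 2 := by
    refine abs_avg_le_of_forall_le (by positivity) fun i => ?_
    rw [abs_mul]
    calc _ ≤ 1 * (η / 2) := mul_le_mul (abs_outcome_sub_equilibrium_le (hζ.trans_lt hb) (hY i))
          ((d.abs_peerMean_le_norm _ i).trans hP) (abs_nonneg _) zero_le_one
      _ = _ := one_mul _
  rw [e]
  linarith [abs_add_le (avg fun i => (Y i - d.equilibrium ζ i) * d.peerMean (d.equilibrium z') i)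
    (avg fun i => (Y i - d.equilibrium ζ i)
      * d.peerMean (d.equilibrium z - d.equilibrium z') i), h3 z' hz']

lemma indepFun_of_data {Ω β : Type*} [MeasurableSpace Ω] [MeasurableSpace β] {μ : Measure Ω}
    {n : ℕ} {D : Ω → GroupDesign n p} {e : Ω → β}
    (h : IndepFun (fun ω => ((D ω).X, (D ω).F)) e μ) : IndepFun D e μ := by
  rw [IndepFun_iff_Indep] at h ⊢
  have hc : MeasurableSpace.comap (fun ω => ((D ω).X, (D ω).F)) inferInstance
      = MeasurableSpace.comap D inferInstance :=
    (MeasurableSpace.comap_comp (g := D) (f := fun d : GroupDesign n p => (d.X, d.F))).symm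
  rwa [hc] at h

section Sequence

variable {Ω : Type*} [MeasurableSpace Ω] {Pr : Measure Ω} [IsProbabilityMeasure Pr] {G : ℕ → ℕ}
  {ζ₀ : ∀ n, Fin (G n) → Param p} {D : ∀ n, Fin (G n) → Ω → GroupDesign n p}
  {ε : ∀ n, Fin (G n) → Fin n → Ω → ℝ} {Y : ∀ n, Fin (G n) → Ω → Fin n → ℝ} {c : ℝ}

lemma wpa1_avg_noise_le (hG : Tendsto (fun n => (G n : ℝ) / n) atTop (𝓝 c))
    (hζ₀ : ∀ n g, |(ζ₀ n g).2 0| < 4)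
    (hDX : ∀ n g, Measurable fun ω => (D n g ω).X)
    (hDF : ∀ n g, Measurable fun ω => (D n g ω).F)
    (hεm : ∀ n g i, Measurable (ε n g i))
    (hεlaw : ∀ n g i, IsStdLogistic Pr (ε n g i))
    (hεindep : ∀ n, iIndepFun (fun (a : Fin (G n) × Fin n) => ε n a.1 a.2) Pr)
    (hεD : ∀ n, IndepFun (fun ω => fun (g : Fin (G n)) => ((D n g ω).X, (D n g ω).F))
      (fun ω => fun (g : Fin (G n)) (i : Fin n) => ε n g i ω) Pr)
    (hY : ∀ n g ω, Y n g ω = (D n g ω).outcome (ζ₀ n g) (fun i => ε n g i ω))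
    {w : ∀ n, GroupDesign n p → Fin n → ℝ} (hwm : ∀ n i, Measurable fun d => w n d i)
    {B t : ℝ} (hB : 0 < B) (hw : ∀ n d i, |w n d i| ≤ B) (ht : 0 < t) :
    WPA1 Pr fun n => {ω | ∀ g, |avg fun i =>
      (Y n g ω i - (D n g ω).equilibrium (ζ₀ n g) i) * w n (D n g ω) i| ≤ t} := by
  refine WPA1.of_exp_bound hG (a := t ^ 2 / (2 * B ^ 2)) (E := fun n g => {ω | |avg fun i =>
      (Y n g ω i - (D n g ω).equilibrium (ζ₀ n g) i) * w n (D n g ω) i| ≤ t})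
    (by positivity) fun n g => ?_
  have hDm : Measurable (D n g) := by
    rw [measurable_comap_iff]
    exact (hDX n g).prodMk (hDF n g)
  have hind : iIndepFun (fun i => ε n g i) Pr :=
    (hεindep n).precomp (g := fun i => (g, i)) (Prod.mk_right_injective g)
  have hDε : IndepFun (D n g) (fun ω i => ε n g i ω) Pr :=
    indepFun_of_data ((hεD n).comp (measurable_pi_apply g) (measurable_pi_apply g))
  refine (measure_mono fun ω hω => ?_).trans (measure_noise_le hDm (hεm n g) (hεlaw n g) hind hDε
    (hζ₀ n g) (hwm n) hB (hw n) ht.le)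
  rw [Set.mem_compl_iff, Set.mem_ofPred_eq, not_le, hY] at hω
  exact hω

/-- The noise is uniformly small over all groups and over the parameter space, with probability
approaching one. -/
lemma wpa1_noiseLE (hG : Tendsto (fun n => (G n : ℝ) / n) atTop (𝓝 c))
    {S : Set (Param p)} (hS : IsCompact S) {b C η : ℝ} (hb : b < 4) (hSb : ∀ z ∈ S, |z.2 0| ≤ b)
    (hζ₀ : ∀ n g, ζ₀ n g ∈ S) (hη : 0 < η)
    (hD : ∀ n, ∀ᵐ ω ∂Pr, ∀ g, (D n g ω).Regular C)
    (hDX : ∀ n g, Measurable fun ω => (D n g ω).X)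
    (hDF : ∀ n g, Measurable fun ω => (D n g ω).F)
    (hεm : ∀ n g i, Measurable (ε n g i))
    (hεlaw : ∀ n g i, IsStdLogistic Pr (ε n g i))
    (hεindep : ∀ n, iIndepFun (fun (a : Fin (G n) × Fin n) => ε n a.1 a.2) Pr)
    (hεD : ∀ n, IndepFun (fun ω => fun (g : Fin (G n)) => ((D n g ω).X, (D n g ω).F))
      (fun ω => fun (g : Fin (G n)) (i : Fin n) => ε n g i ω) Pr)
    (hY : ∀ n g ω, Y n g ω = (D n g ω).outcome (ζ₀ n g) (fun i => ε n g i ω)) :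
    WPA1 Pr fun n => {ω | ∀ g, (D n g ω).NoiseLE (Y n g ω)
      ((D n g ω).equilibrium (ζ₀ n g)) S η} := by
  have hζ4 (n : ℕ) (g : Fin (G n)) : |(ζ₀ n g).2 0| < 4 := (hSb _ (hζ₀ n g)).trans_lt hb
  set L := lipConst p (max C 0) b with hL
  have hL0 : 0 ≤ L := lipConst_nonneg (le_max_right _ _) hb
  obtain ⟨N, hNS, hNfin, hN⟩ := hS.finite_cover_balls
    (show 0 < η / (2 * (L + 1)) by positivity)
  have hr : L * (η / (2 * (L + 1))) ≤ η / 2 := by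
    rw [mul_div_assoc', div_le_div_iff₀ (by positivity) (by positivity)]
    nlinarith
  have e1 := wpa1_avg_noise_le hG hζ4 hDX hDF hεm hεlaw hεindep hεD hY (w := fun n d i => 1)
    (fun n i => measurable_const) one_pos (fun n d i => by simp) hη
  -- covariates are truncated at their almost sure bound
  have e2 := WPA1.forall_mem (Finset.univ : Finset (Fin p)) fun k _ =>
    wpa1_avg_noise_le hG hζ4 hDX hDF hεm hεlaw hεindep hεD hY
      (w := fun n d i => max (-(max C 1)) (min (max C 1) (d.X i k)))
      (fun n i => measurable_const.max (measurable_const.min (measurable_X i k)))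
      (B := max C 1) (lt_max_of_lt_right one_pos)
      (fun n d i => abs_le.2 ⟨le_max_left _ _, max_le
        (by linarith [le_max_right C 1]) (min_le_left _ _)⟩) hη
  have e3 := WPA1.forall_mem hNfin.toFinset fun z hz =>
    wpa1_avg_noise_le hG hζ4 hDX hDF hεm hεlaw hεindep hεD hY
      (w := fun n d i => d.peerMean (d.equilibrium z) i)
      (fun n i => measurable_peerMean (fun j => measurable_equilibrium
        ((hSb z (hNS (hNfin.mem_toFinset.1 hz))).trans_lt hb) j) i) one_pos
      (fun n d i => d.abs_peerMean_le zero_le_one (d.abs_equilibrium_le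
        ((hSb z (hNS (hNfin.mem_toFinset.1 hz))).trans_lt hb)) i) (half_pos hη)
  refine (((e1.inter e2).inter e3).inter (WPA1.of_ae (E := fun n => {ω | ∀ g, (D n g ω).Regular C})
    hD)).mono (.of_forall fun n ω hω g => ?_)
  obtain ⟨⟨⟨h1, h2⟩, h3⟩, h4⟩ := hω
  have hreg : (D n g ω).Regular C := h4 g
  have hC : max C 0 = C := max_eq_left hreg.nonneg
  refine noiseLE_of_net hreg hb hSb (hSb _ (hζ₀ n g)) (fun i => ?_) hNS hN
    (by rw [← hC]; exact hr) hη.le ?_ (fun k => ?_) fun z hz => h3 z (hNfin.mem_toFinset.2 hz) g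
  · rw [hY]; exact outcome_mem_Icc _ _ _ _
  · simpa using h1 g
  · have h5 := h2 k (Finset.mem_univ k) g
    have e (i : Fin n) : max (-(max C 1)) (min (max C 1) ((D n g ω).X i k)) = (D n g ω).X i k := by
      have h6 := abs_le.1 (hreg.abs_X_le i k)
      rw [min_eq_right (h6.2.trans (le_max_left _ _)),
        max_eq_right ((neg_le_neg (le_max_left C 1)).trans h6.1)]
    simpa only [e] using h5

end Sequence

end GroupDesign

/-! ### Consistent classification -/

theorem mainTheorem2 {Ω : Type*} [MeasurableSpace Ω] (Pr : Measure Ω) [IsProbabilityMeasure Pr]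
    (p K₀ : ℕ)
    -- parameter spaces; equilibria are unique on the slope space
    (A : Set ℝ) (Θ : Set (Slope p)) (hA : IsCompact A) (hΘ : IsCompact Θ)
    (hΘ4 : ∀ θ ∈ Θ, |θ 0| < 4)
    -- number of groups
    (G : ℕ → ℕ) (hG : ∃ c : ℝ, 0 ≤ c ∧ Tendsto (fun n => (G n : ℝ) / n) atTop (𝓝 c))
    -- true parameters: distinct cluster slopes, memberships, non-vanishing clusters
    (ϑ₀ : Fin K₀ → Slope p) (hϑ₀ : Function.Injective ϑ₀)
    (κ : ∀ n, Fin (G n) → Fin K₀)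
    (hκ : ∀ k, ∃ c : ℝ, 0 < c ∧
      Tendsto (fun n => ((trueCluster (κ n) k).ncard : ℝ) / G n) atTop (𝓝 c))
    (μ₀ : ∀ n, Fin (G n) → ℝ)
    (ζ₀ : ∀ n, Fin (G n) → Param p) (hζ₀ : ∀ n g, ζ₀ n g = (μ₀ n g, ϑ₀ (κ n g)))
    -- public information and i.i.d. standard logistic shocks, independent of it
    (D : ∀ n, Fin (G n) → Ω → GroupDesign n p)
    (hDX : ∀ n g, Measurable fun ω => (D n g ω).X)
    (hDF : ∀ n g, Measurable fun ω => (D n g ω).F)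
    (ε : ∀ n, Fin (G n) → Fin n → Ω → ℝ)
    (hεm : ∀ n g i, Measurable (ε n g i))
    (hεlaw : ∀ n g i, IsStdLogistic Pr (ε n g i))
    (hεindep : ∀ n, iIndepFun (fun (a : Fin (G n) × Fin n) => ε n a.1 a.2) Pr)
    (hεD : ∀ n, IndepFun (fun ω => fun (g : Fin (G n)) => ((D n g ω).X, (D n g ω).F))
      (fun ω => fun (g : Fin (G n)) (i : Fin n) => ε n g i ω) Pr)
    -- outcomes generated by the model at the true parameters
    (Y : ∀ n, Fin (G n) → Ω → Fin n → ℝ)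
    (hY : ∀ n g ω, Y n g ω = (D n g ω).outcome (ζ₀ n g) (fun i => ε n g i ω))
    -- bounded covariates
    (hX : ∃ C : ℝ, ∀ n, ∀ᵐ ω ∂Pr, ∀ g i, ‖(D n g ω).X i‖ < C)
    -- true values inside the parameter space, true choice probabilities away from 0 and 1
    (hμ₀A : ∃ δ : ℝ, 0 < δ ∧ ∀ n g, Metric.ball (μ₀ n g) δ ⊆ A)
    (hϑ₀Θ : ∀ k, ϑ₀ k ∈ interior Θ)
    (hP₀ : ∃ c : ℝ, 0 < c ∧ c < 1 / 2 ∧ ∀ n, ∀ᵐ ω ∂Pr, ∀ g i,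
      (D n g ω).equilibrium (ζ₀ n g) i ∈ Set.Ioo c (1 - c))
    -- moderate social interactions: the largest true peer effect lies in `(0, 4)`
    (hβ₀ : (∃ k, 0 < |ϑ₀ k 0|) ∧ ∀ k, |ϑ₀ k 0| < 4)
    -- isolated population NPL fixed points
    (hiso : WPA1 Pr fun n => {ω | ∀ g, (D n g ω).IsIsolatedPopFixedPoint A Θ
      (Pr.map fun ω' => fun i => ε n g i ω') (ζ₀ n g)})
    -- bounded total influence of every individual
    (hF : ∃ C : ℝ, ∀ n, ∀ᵐ ω ∂Pr, ∀ g j,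
      ∑ i, (((D n g ω).friends i).card : ℝ)⁻¹ * (if (D n g ω).F i j then 1 else 0) < C)
    -- invertible Jacobians, with inverses bounded uniformly in `n` and `g`
    (hJ : ∃ c : ℝ, 0 < c ∧ WPA1 Pr fun n => {ω | ∀ g, ∀ v : Param p,
      c * ‖v‖ ≤ ‖(D n g ω).nplJacobian (Y n g ω) (ζ₀ n g) v‖})
    -- first-step NPL estimates, wherever a sample NPL fixed point exists
    (ζt : ∀ n, Fin (G n) → Ω → Param p) (Pt : ∀ n, Fin (G n) → Ω → Fin n → ℝ)
    (hNPL : ∀ n, ∀ᵐ ω ∂Pr, ∀ g,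
      ((D n g ω).nplFixedPoints A Θ ((D n g ω).negLogLik (Y n g ω))).Nonempty →
        (D n g ω).IsNPLEstimate A Θ (Y n g ω) (ζt n g ω, Pt n g ω))
    -- C-Lasso estimates with the first-step choice probabilities plugged in
    (ρ : ℕ → ℝ) (hρ : ∀ n, 0 < ρ n)
    (θt : ∀ n, Fin (G n) → Ω → Slope p) (ϑt : ∀ n, Fin K₀ → Ω → Slope p)
    (hCL : ∀ n, ∀ᵐ ω ∂Pr, IsCLassoEstimate A Θ (ρ n) (fun g => D n g ω) (fun g => Y n g ω)
      (fun g => Pt n g ω) (fun g => θt n g ω) (fun k => ϑt n k ω))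
    (hmatch : ∀ n, ∀ᵐ ω ∂Pr, IsMatched (fun k => ϑt n k ω) ϑ₀) :
    ((∀ n, Pr (⋃ k, falseExclusion (κ n) (θt n) (ϑt n) k)
        ≤ ∑ k, Pr (falseExclusion (κ n) (θt n) (ϑt n) k)) ∧
      Tendsto (fun n => ∑ k, Pr (falseExclusion (κ n) (θt n) (ϑt n) k)) atTop (𝓝 0)) ∧
    ((∀ n, Pr (⋃ k, falseInclusion (κ n) (θt n) (ϑt n) k)
        ≤ ∑ k, Pr (falseInclusion (κ n) (θt n) (ϑt n) k)) ∧
      Tendsto (fun n => ∑ k, Pr (falseInclusion (κ n) (θt n) (ϑt n) k)) atTop (𝓝 0)) ∧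
    WPA1 Pr (fun n => {ω | ∀ k, estCluster (fun g => θt n g ω) (fun l => ϑt n l ω) k
      = trueCluster (κ n) k}) := by
  obtain ⟨cG, -, hG⟩ := hG
  obtain ⟨CX, hX⟩ := hX
  obtain ⟨δ, hδ, hμ₀A⟩ := hμ₀A
  obtain ⟨CF, hF⟩ := hF
  obtain ⟨cJ, hcJ, hJ⟩ := hJ
  obtain ⟨k₀, -⟩ := hβ₀.1
  have hKne : Nonempty (Fin K₀) := ⟨k₀⟩
  have hϑ₀mem (k : Fin K₀) : ϑ₀ k ∈ Θ := interior_subset (hϑ₀Θ k)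
  -- uniform constants: the contraction factor, the size of the parameters, the radius of a ball
  -- inside the parameter space, and the smallest cluster share
  obtain ⟨θm, hθm, hmax⟩ := hΘ.exists_isMaxOn ⟨ϑ₀ k₀, hϑ₀mem k₀⟩
    (f := fun θ : Slope p => |θ 0|) (by fun_prop)
  set b := |θm 0| with hb
  have hb4 : b < 4 := hΘ4 θm hθm
  have hSb : ∀ z ∈ A ×ˢ Θ, |z.2 0| ≤ b := fun z hz => hmax hz.2
  have hS : IsCompact (A ×ˢ Θ) := hA.prod hΘ
  obtain ⟨Z, hZ0, hZ⟩ := hS.isBounded.exists_pos_norm_le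
  obtain ⟨R, -, hR⟩ := hΘ.isBounded.exists_pos_norm_le
  obtain ⟨δ', hδ', hball⟩ : ∃ δ' > 0, ∀ n g, Metric.closedBall (ζ₀ n g) δ' ⊆ A ×ˢ Θ := by
    have h1 (k : Fin K₀) : ∃ r > 0, Metric.closedBall (ϑ₀ k) r ⊆ Θ :=
      Metric.nhds_basis_closedBall.mem_iff.1 (mem_interior_iff_mem_nhds.1 (hϑ₀Θ k))
    choose r hr hrΘ using h1
    obtain ⟨k₁, hk₁⟩ := Finite.exists_min r
    refine ⟨min (δ / 2) (r k₁), lt_min (half_pos hδ) (hr k₁), fun n g => ?_⟩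
    rw [hζ₀, ← closedBall_prod_same]
    refine Set.prod_mono ?_ ?_
    · refine (Metric.closedBall_subset_ball ?_).trans (hμ₀A n g)
      exact (min_le_left _ _).trans_lt (half_lt_self hδ)
    · exact (Metric.closedBall_subset_closedBall ((min_le_right _ _).trans (hk₁ _))).trans
        (hrΘ (κ n g))
  have hζ₀S (n : ℕ) (g : Fin (G n)) : ζ₀ n g ∈ A ×ˢ Θ :=
    hball n g (Metric.mem_closedBall_self hδ'.le)
  choose share hshare0 hshare using hκ
  obtain ⟨k₁, hk₁⟩ := Finite.exists_min share
  have hπ : 0 < share k₁ / 2 := half_pos (hshare0 k₁)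
  have hfrac : ∀ᶠ n in atTop, ∀ k, share k₁ / 2 ≤ ((trueCluster (κ n) k).ncard : ℝ) / G n := by
    refine eventually_all.2 fun k => ?_
    refine ((hshare k).eventually_const_lt (u := share k₁ / 2) ?_).mono fun n hn => hn.le
    linarith [hk₁ k, hshare0 k₁]
  set C := max (max CX CF) 0 with hC
  have hC0 : 0 ≤ C := le_max_right _ _
  have hreg (n : ℕ) : ∀ᵐ ω ∂Pr, ∀ g, (D n g ω).Regular C := by
    filter_upwards [hX n, hF n] with ω h1 h2 g
    refine ⟨hC0, fun i k => ?_, fun j => ?_⟩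
    · exact (norm_le_pi_norm ((D n g ω).X i) k).trans
        ((h1 g i).le.trans ((le_max_left _ _).trans (le_max_left _ _)))
    · exact (h2 g j).le.trans ((le_max_right _ _).trans (le_max_left _ _))
  -- accuracies: `Δ / 8` for the estimates, `ω₀` for the profile criteria, `η` for the noise
  obtain ⟨Δ, hΔ0, hΔ⟩ := exists_separation hϑ₀
  obtain ⟨a, ha, Λ, hΛ, hprof⟩ :=
    GroupDesign.exists_profile_bound p hC0 hb4 hδ' hcJ hZ0.le
  obtain ⟨ω₀, hω₀, hlasso⟩ := exists_cLasso_bound (R := R) Θ hR hϑ₀mem hϑ₀ ha hΛ hπ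
    (show 0 < Δ / 8 by positivity)
  obtain ⟨η, hη, hgroup⟩ := hprof ω₀ hω₀
  have hnoise := GroupDesign.wpa1_noiseLE hG hS hb4 hSb hζ₀S hη hreg hDX hDF hεm hεlaw hεindep
    hεD hY
  have hae : ∀ n, ∀ᵐ ω ∂Pr, ω ∈ {ω | (∀ g, (D n g ω).Regular C) ∧
      (∀ g, ((D n g ω).nplFixedPoints A Θ ((D n g ω).negLogLik (Y n g ω))).Nonempty →
        (D n g ω).IsNPLEstimate A Θ (Y n g ω) (ζt n g ω, Pt n g ω)) ∧
      IsCLassoEstimate A Θ (ρ n) (fun g => D n g ω) (fun g => Y n g ω)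
        (fun g => Pt n g ω) (fun g => θt n g ω) (fun k => ϑt n k ω) ∧
      IsMatched (fun k => ϑt n k ω) ϑ₀} := by
    intro n
    filter_upwards [hreg n, hNPL n, hCL n, hmatch n] with ω h1 h2 h3 h4
    exact ⟨h1, h2, h3, h4⟩
  have hmain : WPA1 Pr (fun n => {ω | ∀ k, estCluster (fun g => θt n g ω) (fun l => ϑt n l ω) k
      = trueCluster (κ n) k}) := by
    refine ((hJ.inter hnoise).inter (WPA1.of_ae hae)).mono ?_
    filter_upwards [hfrac] with n hn
    rintro ω ⟨⟨hJω, hnω⟩, hregω, hNPLω, ⟨hθ, hϑ, hmin⟩, hmω⟩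
    -- an empty collection of groups has cluster shares `0 / 0 = 0`
    have hGn : 0 < G n := by
      rcases Nat.eq_zero_or_pos (G n) with h | h
      · have h1 := hn k₀
        have h2 : (G n : ℝ) = 0 := by exact_mod_cast h
        rw [h2, div_zero] at h1
        linarith
      · exact h
    have hadm (g : Fin (G n)) : (D n g ω).Admissible (A ×ˢ Θ) (Y n g ω) (ζ₀ n g) C b δ' cJ :=
      { regular := hregω g
        lt_four := hb4
        peer_le := hSb
        outcome_mem := fun i => by rw [hY]; exact GroupDesign.outcome_mem_Icc _ _ _ _
        ball_subset := hball n g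
        radius_pos := hδ'
        jacobian_pos := hcJ
        jacobian_le := hJω g }
    have hbd (g : Fin (G n)) := hgroup n (D n g ω) A Θ (Y n g ω) (ζ₀ n g) hA hZ (hadm g) (hnω g)
    have hest (g : Fin (G n)) := (hbd g).2 _ (hNPLω g (hbd g).1)
    have hsl (g : Fin (G n)) : (ζ₀ n g).2 = ϑ₀ (κ n g) := by rw [hζ₀]
    obtain ⟨h1, h2⟩ := hlasso (G n) (κ n)
      (fun g θ => (D n g ω).profile A (Y n g ω) θ (Pt n g ω)) (ρ n) (fun g => θt n g ω)
      (fun k => ϑt n k ω) hGn (hρ n) hn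
      (fun g θ hθ => by have := (hest g).1 θ hθ; rwa [hsl] at this)
      (fun g => (hest g).2) hθ hϑ
      (fun θ' ϑ' h1 h2 => by
        have := hmin θ' ϑ' h1 h2
        rwa [cLassoObjective_eq, cLassoObjective_eq] at this) hmω
    exact fun k => estCluster_eq_trueCluster
      (fun k l hkl => by linarith [hΔ k l hkl]) h1 h2 k
  have hexcl (k : Fin K₀) :
      Tendsto (fun n => Pr (falseExclusion (κ n) (θt n) (ϑt n) k)) atTop (𝓝 0) := by
    refine tendsto_of_tendsto_of_tendsto_of_le_of_le tendsto_const_nhds hmain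
      (fun _ => zero_le) fun n => measure_mono ?_
    rintro ω ⟨g, hg, hg'⟩ hω
    exact hg' ((hω k).symm ▸ hg)
  have hincl (k : Fin K₀) :
      Tendsto (fun n => Pr (falseInclusion (κ n) (θt n) (ϑt n) k)) atTop (𝓝 0) := by
    refine tendsto_of_tendsto_of_tendsto_of_le_of_le tendsto_const_nhds hmain
      (fun _ => zero_le) fun n => measure_mono ?_
    rintro ω ⟨g, hg, hg'⟩ hω
    exact hg' (hω k ▸ hg)
  refine ⟨⟨fun n => measure_iUnion_fintype_le _ _, ?_⟩,
    ⟨fun n => measure_iUnion_fintype_le _ _, ?_⟩, hmain⟩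
  · simpa using tendsto_finsetSum Finset.univ fun k _ => hexcl k
  · simpa using tendsto_finsetSum Finset.univ fun k _ => hincl k
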